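/- For $k\ge 1$ and $d\ge 2$ let $\mathrm{CONJ}_{k,d}$ (resp. $\mathrm{DISJ}_{k,d}$) be the class of all conjunctions (resp. disjunctions) of at most $k$ literals over $d$ Boolean variables, viewed as concepts $\{0,1\}^d\to\{0,1\}$; the empty conjunction is true and the empty disjunction is false. A randomized algorithm $\mathcal A$ on databases of size $n$ is $(\varepsilon,\delta)$-differentially private if $\Pr[\mathcal A(S)\in T]\le e^{\varepsilon}\Pr[\mathcal A(S')\in T]+\delta$ for all databases $S,S'$ of size $n$ that differ in a single entry and all events $T$. It is an $(\alpha,\beta)$-PAC learner for a class $C$ of concepts on $X$ with sample size $n$ if for every probability distribution $\mathcal D$ on $X$ and every $c\in C$, when $x_1,\dots,x_n$ are drawn i.i.d. from $\mathcal D$ and $h=\mathcal A((x_i,c(x_i))_{i=1}^n)$, then $\Pr\big[\Pr_{x\sim\mathcal D}[h(x)\ne c(x)]>\alpha\big]\le\beta$, the outer probability being over the sample and the coins of $\mathcal A$. **Theorem.** There are constants $c\in\mathbb R$ and $m\in\mathbb N$ such that, with $$N(k,d,\alpha,\beta,\varepsilon,\delta)=c\cdot\frac{1}{\alpha\varepsilon}\,k\log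 d\cdot\Big(\log\frac{2k}{\alpha\beta\varepsilon\delta}\Big)^{m}=\tilde O\Big(\frac{1}{\alpha\varepsilon}\,k\log d\Big)$$ (the $\tilde O$ hides factors polylogarithmic in $k,1/\alpha,1/\beta,1/\varepsilon,1/\delta$ only), the following holds. There is a single randomized algorithm which, given $k\ge 1$, $d\ge 2$, the numbers $\lceil 1/\alpha\rceil,\lceil 1/\beta\rceil,\lceil 1/\varepsilon\rceil,\lceil 1/\delta\rceil$ for any real $\alpha,\beta,\varepsilon,\delta\in(0,1)$, and a labeled database $S\in(\{0,1\}^d\times\{0,1\})^n$ of any size $n$, outputs a list of literals over the $d$ variables, to be read as their conjunction, such that 1. (efficiency) the algorithm, run on a probabilistic random access machine that uses fair coin flips and has addition, truncated subtraction and halving as its unit-cost arithmetic, always halts within a number of steps polynomial in $n+d+k+1/\alpha+1/\varepsilon+\log(1/\beta)+\log(1/\delta)$; 2. (privacy) its output is $(\varepsilon,\delta)$-differentially private, for every $n$; 3. (learning) for every $n\ge N(k,d,\alpha,\beta,\varepsilon,\delta)$ it is an $(\alpha,\beta)$-PAC learner for $\mathrm{CONJ}_{k,d}$ with sample size $n$.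 There is likewise such an algorithm for $\mathrm{DISJ}_{k,d}$, with the same $c$ and $m$, whose output is read as a disjunction of literals. -/

import Mathlib

open MeasureTheory
open scoped ENNReal

namespace PrivateLearning

/-! ### Literals, conjunctions and disjunctions -/

/-- A literal over `d` Boolean variables: `(i, true)` is the variable `v_i` and `(i, false)` its
negation. -/
abbrev Literal (d : ℕ) : Type := Fin d × Bool

/-- The truth value of a literal under an assignment. -/
def Literal.eval {d : ℕ} (l : Literal d) (x : Fin d → Bool) : Bool := x l.1 == l.2

/-- The conjunction of a list of literals (the empty conjunction is true). -/
def conjEval {d : ℕ} (φ : List (Literal d)) (x : Fin d → Bool) : Bool := φ.all fun l => l.eval x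

/-- The disjunction of a list of literals (the empty disjunction is false). -/
def disjEval {d : ℕ} (φ : List (Literal d)) (x : Fin d → Bool) : Bool := φ.any fun l => l.eval x

/-- `CONJ_{k,d}`: conjunctions of at most `k` literals over `d` variables. -/
def CONJ (k d : ℕ) : Set ((Fin d → Bool) → Bool) :=
  {c | ∃ φ : List (Literal d), φ.length ≤ k ∧ c = conjEval φ}

/-- `DISJ_{k,d}`: disjunctions of at most `k` literals over `d` variables. -/
def DISJ (k d : ℕ) : Set ((Fin d → Bool) → Bool) :=
  {c | ∃ φ : List (Literal d), φ.length ≤ k ∧ c = disjEval φ}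

/-! ### Differential privacy and PAC learning -/

/-- Two databases of the same size are neighboring if they differ on (at most) a single entry. -/
def Neighboring {n : ℕ} {Z : Type*} (S S' : Fin n → Z) : Prop :=
  ∃ i, ∀ j, j ≠ i → S j = S' j

/-- `(ε, δ)`-differential privacy of a randomized algorithm `A` on databases of size `n`;
`A S` is the distribution of the output on `S`. -/
def IsDifferentiallyPrivate {n : ℕ} {Z O : Type*} (ε δ : ℝ) (A : (Fin n → Z) → PMF O) : Prop :=
  ∀ S S' : Fin n → Z, Neighboring S S' → ∀ T : Set O,
    (A S).toOuterMeasure T ≤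
      ENNReal.ofReal (Real.exp ε) * (A S').toOuterMeasure T + ENNReal.ofReal δ

/-- The generalization error `Pr_{x ∼ D}[h x ≠ c x]`. -/
def genError {X : Type*} [MeasurableSpace X] (D : Measure X) (c h : X → Bool) : ℝ≥0∞ :=
  D {x | h x ≠ c x}

/-- `A` is an `(α, β)`-PAC learner for the class `C` with sample size `n`: for all `D` and all
`c ∈ C`, the probability, over the i.i.d. labeled sample and the coins of `A`, that the returned
hypothesis has error more than `α` is at most `β`. -/
def IsPACLearner {n : ℕ} {X : Type*} [MeasurableSpace X] (α β : ℝ) (C : Set (X → Bool))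
    (A : (Fin n → X × Bool) → PMF (X → Bool)) : Prop :=
  ∀ D : Measure X, IsProbabilityMeasure D → ∀ c ∈ C,
    ∫⁻ x : Fin n → X,
        (A fun i => (x i, c (x i))).toOuterMeasure {h | ENNReal.ofReal α < genError D c h}
      ∂(Measure.pi fun _ : Fin n => D) ≤ ENNReal.ofReal β

/-! ### Probabilistic random access machines

Programs over registers `R_0, R_1, …` and a memory `M[0], M[1], …`, all holding natural numbers,
with structured control flow. Every elementary command, every test and every unfolding of a
sequential composition takes one step. The only arithmetic is addition, truncated subtraction and
halving, so each step lengthens numbers by at most one bit; hence (as usual for unit-cost machines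
without multiplication) polynomially many steps amount to polynomial time on a probabilistic Turing
machine. The source of randomness is a fair coin. -/

/-- Programs. -/
inductive Program : Type
  /-- do nothing -/
  | skip : Program
  /-- `R_x := c` -/
  | const (x c : ℕ) : Program
  /-- `R_x := R_y` -/
  | copy (x y : ℕ) : Program
  /-- `R_x := R_y + R_z` -/
  | add (x y z : ℕ) : Program
  /-- `R_x := max (R_y - R_z) 0` -/
  | sub (x y z : ℕ) : Program
  /-- `R_x := ⌊R_y / 2⌋` -/
  | half (x y : ℕ) : Program
  /-- `R_x := M[R_y]` -/
  | load (x y : ℕ) : Program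
  /-- `M[R_x] := R_y` -/
  | store (x y : ℕ) : Program
  /-- `R_x :=` a fresh uniformly random bit -/
  | flip (x : ℕ) : Program
  /-- append `R_x` to the output -/
  | emit (x : ℕ) : Program
  /-- first `p`, then `q` -/
  | seq (p q : Program) : Program
  /-- if `R_x ≠ 0` then `p` else `q` -/
  | cond (x : ℕ) (p q : Program) : Program
  /-- while `R_x ≠ 0` do `p` -/
  | loop (x : ℕ) (p : Program) : Program

/-- A configuration: the programs still to be executed (in this order), the contents of registers
and memory, and the output written so far. -/
@[ext]
structure Config where
  todo : List Program
  reg : ℕ → ℕ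
  mem : ℕ → ℕ
  out : List ℕ

namespace Config

/-- Continue with `K` after setting the register `x` to `v`. -/
def setReg (s : Config) (K : List Program) (x v : ℕ) : Config :=
  { s with todo := K, reg := Function.update s.reg x v }

/-- One step of computation. A configuration with nothing left to do has halted. -/
noncomputable def step (s : Config) : PMF Config :=
  match s.todo with
  | [] => PMF.pure s
  | .skip :: K => PMF.pure { s with todo := K }
  | .const x c :: K => PMF.pure (s.setReg K x c)
  | .copy x y :: K => PMF.pure (s.setReg K x (s.reg y))
  | .add x y z :: K => PMF.pure (s.setReg K x (s.reg y + s.reg z))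
  | .sub x y z :: K => PMF.pure (s.setReg K x (s.reg y - s.reg z))
  | .half x y :: K => PMF.pure (s.setReg K x (s.reg y / 2))
  | .load x y :: K => PMF.pure (s.setReg K x (s.mem (s.reg y)))
  | .store x y :: K =>
      PMF.pure { s with todo := K, mem := Function.update s.mem (s.reg x) (s.reg y) }
  | .flip x :: K => (PMF.uniformOfFintype Bool).map fun b => s.setReg K x b.toNat
  | .emit x :: K => PMF.pure { s with todo := K, out := s.out ++ [s.reg x] }
  | .seq p q :: K => PMF.pure { s with todo := p :: q :: K }
  | .cond x p q :: K => PMF.pure { s with todo := (if s.reg x ≠ 0 then p else q) :: K }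
  | .loop x p :: K =>
      PMF.pure { s with todo := if s.reg x ≠ 0 then p :: .loop x p :: K else K }

/-- The distribution of the configuration after `t` steps. -/
noncomputable def run : ℕ → Config → PMF Config
  | 0, s => PMF.pure s
  | t + 1, s => s.step.bind (run t)

/-- The output of a halted configuration, `none` if the configuration has not halted. -/
def result (s : Config) : Option (List ℕ) :=
  if s.todo.isEmpty then some s.out else none

/-- The initial configuration on the input `w`: memory holds `w`, and `R_0` holds its length. -/
def init (M : Program) (w : List ℕ) : Config where
  todo := [M]
  reg := Function.update (fun _ => 0) 0 w.length
  mem := fun i => w.getD i 0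
  out := []

end Config

/-- On input `w`, the program `M` always halts within `t` steps, and the distribution of its output
is `μ`. -/
def Program.HasOutputLaw (M : Program) (t : ℕ) (w : List ℕ) (μ : PMF (List ℕ)) : Prop :=
  (Config.run t (Config.init M w)).map Config.result = μ.map some

/-! ### Efficient private learners -/

/-- The input of a learner: the numbers `k, d, n`, the parameters (each given by the natural number
`⌈1 / parameter⌉`), and the `n` labeled examples, each written as `d + 1` bits. -/
noncomputable def learnerInput {n d : ℕ} (k : ℕ) (α β ε δ : ℝ)
    (S : Fin n → (Fin d → Bool) × Bool) : List ℕ :=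
  [k, d, n, ⌈1 / α⌉₊, ⌈1 / β⌉₊, ⌈1 / ε⌉₊, ⌈1 / δ⌉₊] ++
    (List.ofFn S).flatMap fun z => (List.ofFn fun i => (z.1 i).toNat) ++ [z.2.toNat]

/-- The output of a learner: the literal `v_i` is written as `2 i + 1`, its negation as `2 i`. -/
def encodeFormula {d : ℕ} (φ : List (Literal d)) : List ℕ :=
  φ.map fun l => 2 * (l.1 : ℕ) + l.2.toNat

/-- The size parameter of a learning problem, in which running times are measured: up to a constant
factor it is `n + d + k + 1/α + 1/ε + log (1/β) + log (1/δ)`. -/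
noncomputable def problemSize (n k d : ℕ) (α β ε δ : ℝ) : ℕ :=
  n + d + k + ⌈1 / α⌉₊ + ⌈1 / ε⌉₊ + Nat.size ⌈1 / β⌉₊ + Nat.size ⌈1 / δ⌉₊

/-- There are efficient `(ε, δ)`-differentially private `(α, β)`-PAC learners for the classes
`C k d` with sample complexity `N k d α β ε δ`: a single probabilistic program `M`, running in
polynomial time and returning formulas that `eval` interprets as hypotheses, which is
differentially private on samples of any size, and a PAC learner on samples of size at
least `N k d α β ε δ`. -/
def HasEfficientPrivateLearner (C : (k d : ℕ) → Set ((Fin d → Bool) → Bool))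
    (eval : (d : ℕ) → List (Literal d) → (Fin d → Bool) → Bool)
    (N : (k d : ℕ) → (α β ε δ : ℝ) → ℝ) : Prop :=
  ∃ (M : Program) (P : Polynomial ℕ), ∀ k d : ℕ, 1 ≤ k → 2 ≤ d →
    ∀ α ∈ Set.Ioo (0 : ℝ) 1, ∀ β ∈ Set.Ioo (0 : ℝ) 1,
    ∀ ε ∈ Set.Ioo (0 : ℝ) 1, ∀ δ ∈ Set.Ioo (0 : ℝ) 1, ∀ n : ℕ,
    ∃ A : (Fin n → (Fin d → Bool) × Bool) → PMF (List (Literal d)),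
      (∀ S, M.HasOutputLaw (P.eval (problemSize n k d α β ε δ)) (learnerInput k α β ε δ S)
        ((A S).map encodeFormula)) ∧
      IsDifferentiallyPrivate ε δ A ∧
      (N k d α β ε δ ≤ (n : ℝ) →
        IsPACLearner α β (C k d) fun S => (A S).map (eval d))

end PrivateLearning

/-!
The learner is a private version of the greedy algorithm for set cover. Conjunctions and
disjunctions are treated together: for a polarity `f`, a literal fires on an example if it has the truth value
`f` there, and a list of literals has the value `f` exactly where one of them fires (`f = false` for
conjunctions, `f = true` for disjunctions). A good list fires on all examples with label `f` and on
few others.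

**Algorithm.** The learner (`learn`) works through a fixed list of queries (`schedule`): in each of
`J ≈ log (k / α)` passes it asks about every literal, with a threshold `τ` that is halved from pass
to pass. The deficit of a literal measures how far it is from firing on `τ` of the remaining
examples with label `f` and on none with label `!f`. A coin (`queryCoin`) with probability of heads
`1 - (1 - r ^ u / 2) ^ T`, where `u` is the deficit and `r = 1 - 2 ^ (-q)`, decides whether the
literal is selected; if so, all examples on which it fires are removed.

**Privacy** (`pr_learn_le`, `isDifferentiallyPrivate_learn`). The privacy loss does not grow with
the number of selected literals. An example influences only queries about literals that fire on it,
and it is removed by the first of these that is selected. Until then the loss incurred by tails is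
proportional to the probability that heads would have come up, so exhausting the allowance of
privacy loss without being removed is exponentially unlikely. This is an induction on the
queries with an exponential potential, and it allows `2 ^ q ≈ log (1 / δ) / ε`.

**Utility** (`pr_not_typical_le`, `Typical.errorCount_le`). With high probability no literal of
deficit zero is passed over, and none with a deficit of at least `E ≈ 2 ^ q T` is selected. After
a pass with threshold `τ` each of the `k` target literals fires on fewer than `τ` remaining examples
with label `f`, so at most `k τ` of these are left. As every selection in the next pass removes at
least about `τ / 4` of them, that pass makes only `O(k)` selections. In the end `O(k J)` literals have been
selected, each of them wrong on at most `E` examples. A Chernoff bound and a union bound over the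
short lists of literals (`isPACLearner_of_errorCount`) turn a small empirical error into a small
generalization error.

**Efficiency** (`halts_learnerProgram`, `learnerTime_le`). Every coin is a Boolean combination of
fair coin flips, so the machine produces the law of `learn` exactly. `Halts` is a
continuation-passing specification of programs: the step bound and the output law of a
configuration are derived from those of the configurations that follow. A removed example is marked
in the memory by overwriting its label with `2`.
-/

namespace PrivateLearning

/-! ### Probabilities of events as real numbers -/

/-- The probability of the event `A`, as a real number. -/
noncomputable def pr {O : Type*} (μ : PMF O) (A : Set O) : ℝ := (μ.toOuterMeasure A).toReal

section Pr

variable {O O' : Type*}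

lemma toOuterMeasure_le_one (μ : PMF O) (A : Set O) : μ.toOuterMeasure A ≤ 1 := by
  calc μ.toOuterMeasure A ≤ μ.toOuterMeasure Set.univ := measure_mono (Set.subset_univ _)
    _ = 1 := (μ.toOuterMeasure_apply_eq_one_iff _).2 (Set.subset_univ _)

lemma toOuterMeasure_ne_top (μ : PMF O) (A : Set O) : μ.toOuterMeasure A ≠ ∞ :=
  ne_top_of_le_ne_top ENNReal.one_ne_top (toOuterMeasure_le_one μ A)

lemma ofReal_pr (μ : PMF O) (A : Set O) : ENNReal.ofReal (pr μ A) = μ.toOuterMeasure A :=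
  ENNReal.ofReal_toReal (toOuterMeasure_ne_top μ A)

lemma pr_nonneg (μ : PMF O) (A : Set O) : 0 ≤ pr μ A := ENNReal.toReal_nonneg

lemma pr_le_one (μ : PMF O) (A : Set O) : pr μ A ≤ 1 :=
  ENNReal.toReal_le_of_le_ofReal zero_le_one (by simpa using toOuterMeasure_le_one μ A)

lemma pr_mono (μ : PMF O) {A B : Set O} (h : A ⊆ B) : pr μ A ≤ pr μ B :=
  ENNReal.toReal_mono (toOuterMeasure_ne_top μ B) (measure_mono h)

lemma pr_map (μ : PMF O) (g : O → O') (A : Set O') : pr (μ.map g) A = pr μ (g ⁻¹' A) := by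
  simp [pr, PMF.toOuterMeasure_map_apply]

lemma pr_pure_of_notMem {a : O} {A : Set O} (h : a ∉ A) : pr (PMF.pure a) A = 0 := by
  simp [pr, PMF.toOuterMeasure_pure_apply, h]

/-- The probability that a random bit is `true`. -/
noncomputable def heads (μ : PMF Bool) : ℝ := (μ true).toReal

lemma heads_nonneg (μ : PMF Bool) : 0 ≤ heads μ := ENNReal.toReal_nonneg

lemma heads_le_one (μ : PMF Bool) : heads μ ≤ 1 :=
  ENNReal.toReal_le_of_le_ofReal zero_le_one (by simpa using μ.coe_le_one true)

lemma toReal_apply_false (μ : PMF Bool) : (μ false).toReal = 1 - heads μ := by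
  have h := μ.tsum_coe
  rw [tsum_fintype, Fintype.sum_bool] at h
  have := congrArg ENNReal.toReal h
  rw [ENNReal.toReal_add (μ.apply_ne_top _) (μ.apply_ne_top _), ENNReal.toReal_one] at this
  unfold heads; linarith

lemma pr_bind_bool (μ : PMF Bool) (g : Bool → PMF O) (A : Set O) :
    pr (μ.bind g) A = heads μ * pr (g true) A + (1 - heads μ) * pr (g false) A := by
  rw [← toReal_apply_false, pr, PMF.toOuterMeasure_bind_apply, tsum_fintype, Fintype.sum_bool,
    ENNReal.toReal_add, ENNReal.toReal_mul, ENNReal.toReal_mul]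
  · rfl
  all_goals exact ENNReal.mul_ne_top (μ.apply_ne_top _) (toOuterMeasure_ne_top _ _)

lemma heads_eq_pr (μ : PMF Bool) : heads μ = pr μ {true} := by
  simp [heads, pr]

end Pr

/-! ### The coin of a query -/

/-- A fair coin. -/
noncomputable abbrev fairCoin : PMF Bool := PMF.uniformOfFintype Bool

/-- The disjunction of `m` independent copies of a random bit. -/
noncomputable def orRepeat (μ : PMF Bool) : ℕ → PMF Bool
  | 0 => PMF.pure false
  | m + 1 => μ.bind fun b => (orRepeat μ m).map (b || ·)

/-- The conjunction of `m` independent copies of a random bit. -/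
noncomputable def andRepeat (μ : PMF Bool) : ℕ → PMF Bool
  | 0 => PMF.pure true
  | m + 1 => μ.bind fun b => (andRepeat μ m).map (b && ·)

/-- A random bit that is `true` with probability `(1 - 2 ^ (-q)) ^ u / 2`, generated by fair coin
flips. -/
noncomputable def trial (q u : ℕ) : PMF Bool :=
  fairCoin.bind fun c => (andRepeat (orRepeat fairCoin q) u).map (c && ·)

/-- The coin that decides a query of deficit `u`: is one of `T` independent trials successful? -/
noncomputable def queryCoin (q T u : ℕ) : PMF Bool := orRepeat (trial q u) T

lemma heads_fairCoin : heads fairCoin = 1 / 2 := by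
  simp [heads, PMF.uniformOfFintype_apply]

lemma heads_bind (μ : PMF Bool) (g : Bool → PMF Bool) :
    heads (μ.bind g) = heads μ * heads (g true) + (1 - heads μ) * heads (g false) := by
  simp only [heads_eq_pr (μ.bind g), heads_eq_pr (g _), pr_bind_bool]

lemma heads_map_true_or (μ : PMF Bool) : heads (μ.map (true || ·)) = 1 := by
  have : heads (PMF.pure true) = 1 := by simp [heads]
  rw [PMF.map, heads_bind]
  simp only [Function.comp_apply, Bool.true_or, this]
  ring

lemma heads_map_false_or (μ : PMF Bool) : heads (μ.map (false || ·)) = heads μ := by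
  have : (fun b : Bool => (false || b)) = id := by ext b; simp
  rw [this, PMF.map_id]

lemma heads_map_true_and (μ : PMF Bool) : heads (μ.map (true && ·)) = heads μ := by
  have : (fun b : Bool => (true && b)) = id := by ext b; simp
  rw [this, PMF.map_id]

lemma heads_map_false_and (μ : PMF Bool) : heads (μ.map (false && ·)) = 0 := by
  simp [heads_eq_pr, pr]

lemma heads_orRepeat (μ : PMF Bool) (m : ℕ) : heads (orRepeat μ m) = 1 - (1 - heads μ) ^ m := by
  induction m with
  | zero => simp [orRepeat, heads]
  | succ m ih =>
    rw [orRepeat, heads_bind, heads_map_true_or, heads_map_false_or, ih]; ring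

lemma heads_andRepeat (μ : PMF Bool) (m : ℕ) : heads (andRepeat μ m) = heads μ ^ m := by
  induction m with
  | zero => simp [andRepeat, heads]
  | succ m ih =>
    rw [andRepeat, heads_bind, heads_map_true_and, heads_map_false_and, ih]; ring

lemma heads_trial (q u : ℕ) : heads (trial q u) = (1 - (1 / 2) ^ q) ^ u / 2 := by
  rw [trial, heads_bind, heads_map_true_and, heads_map_false_and, heads_andRepeat, heads_orRepeat,
    heads_fairCoin]
  norm_num; ring

lemma heads_queryCoin (q T u : ℕ) :
    heads (queryCoin q T u) = 1 - (1 - heads (trial q u)) ^ T := heads_orRepeat _ _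

lemma heads_trial_le_half (q u : ℕ) : heads (trial q u) ≤ 1 / 2 := by
  rw [heads_trial]
  have h1 : (1 / 2 : ℝ) ^ q ≤ 1 := pow_le_one₀ (by norm_num) (by norm_num)
  have h2 : (1 - (1 / 2 : ℝ) ^ q) ^ u ≤ 1 :=
    pow_le_one₀ (by linarith) (by linarith [pow_pos (by norm_num : (0 : ℝ) < 1 / 2) q])
  linarith

/-- Changing the deficit by at most one changes the success probability of a trial by a factor of
at most `1 + 2 ^ (1 - q)`. -/
lemma heads_trial_le {q u u' : ℕ} (hq : 1 ≤ q) (h : u ≤ u' + 1) :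
    heads (trial q u') ≤ (1 + 2 * (1 / 2) ^ q) * heads (trial q u) := by
  rw [heads_trial, heads_trial]
  set y : ℝ := (1 / 2) ^ q
  have hy0 : 0 < y := by positivity
  have hy : y ≤ 1 / 2 := by
    calc y ≤ (1 / 2) ^ 1 := pow_le_pow_of_le_one (by norm_num) (by norm_num) hq
      _ = 1 / 2 := by norm_num
  have h1 : (1 - y) ^ (u' + 1) ≤ (1 - y) ^ u := pow_le_pow_of_le_one (by linarith) (by linarith) h
  have h2 : (1 - y) ^ u' ≤ (1 + 2 * y) * (1 - y) ^ (u' + 1) := by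
    have : 0 ≤ (1 - y) ^ u' * (y * (1 - 2 * y)) :=
      mul_nonneg (pow_nonneg (by linarith) _) (mul_nonneg hy0.le (by linarith))
    rw [pow_succ]; nlinarith
  have := mul_le_mul_of_nonneg_left h1 (by linarith : 0 ≤ 1 + 2 * y)
  linarith

/-- Adjacent deficits give nearly equal probabilities of heads. -/
lemma heads_queryCoin_le {q T u u' : ℕ} (hq : 1 ≤ q) (h : u ≤ u' + 1) :
    heads (queryCoin q T u') ≤ (1 + 2 * (1 / 2) ^ q) * heads (queryCoin q T u) := by
  rw [heads_queryCoin, heads_queryCoin]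
  have key := heads_trial_le hq h
  have h0 := heads_nonneg (trial q u)
  have h0' := heads_nonneg (trial q u')
  have h1 := heads_le_one (trial q u)
  have h1' := heads_le_one (trial q u')
  set p := heads (trial q u)
  set p' := heads (trial q u')
  set y : ℝ := (1 / 2) ^ q
  have hy0 : 0 < y := by positivity
  have expand : ∀ x : ℝ, 1 - (1 - x) ^ T = x * ∑ i ∈ Finset.range T, (1 - x) ^ i := fun x => by
    have := geom_sum_mul (1 - x) T
    linarith
  rcases le_total p' p with hle | hle
  · have : (1 - p) ^ T ≤ (1 - p') ^ T := pow_le_pow_left₀ (by linarith) (by linarith) T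
    have h2 : (1 - p) ^ T ≤ 1 := pow_le_one₀ (by linarith) (by linarith)
    nlinarith
  · rw [expand, expand, ← mul_assoc]
    refine mul_le_mul key (Finset.sum_le_sum fun i _ => ?_) ?_ ?_
    · exact pow_le_pow_left₀ (by linarith) (by linarith) i
    · exact Finset.sum_nonneg fun i _ => pow_nonneg (by linarith) i
    · exact mul_nonneg (by linarith) h0

/-- Adjacent deficits give probabilities of tails whose ratio is close to one in terms of the
probability of success itself: tails cost little privacy if heads were unlikely. -/
lemma tails_queryCoin_le {q T u u' : ℕ} (hq : 1 ≤ q) (h : u' ≤ u + 1) :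
    1 - heads (queryCoin q T u') ≤ (1 - heads (queryCoin q T u)) *
      Real.exp (2 * (2 * (1 / 2) ^ q) * (T * heads (trial q u'))) := by
  rw [heads_queryCoin, heads_queryCoin]
  have key := heads_trial_le hq h
  have hh := heads_trial_le_half q u
  have h0' := heads_nonneg (trial q u')
  have hh' := heads_trial_le_half q u'
  set p := heads (trial q u)
  set p' := heads (trial q u')
  set y : ℝ := (1 / 2) ^ q
  have hy0 : 0 < y := by positivity
  have h1 : 1 - p' ≤ (1 - p) * Real.exp (2 * (2 * y) * p') := by
    have h2 := Real.add_one_le_exp (2 * (2 * y) * p')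
    have h3 : (1 - p) * (2 * (2 * y) * p' + 1) ≤ (1 - p) * Real.exp (2 * (2 * y) * p') :=
      mul_le_mul_of_nonneg_left h2 (by linarith)
    nlinarith [mul_nonneg (mul_nonneg hy0.le h0') (by linarith : 0 ≤ 1 - 2 * p)]
  calc 1 - (1 - (1 - p') ^ T) = (1 - p') ^ T := by ring
    _ ≤ ((1 - p) * Real.exp (2 * (2 * y) * p')) ^ T := pow_le_pow_left₀ (by linarith) h1 T
    _ = _ := by rw [mul_pow, ← Real.exp_nat_mul]; ring_nf

/-- Passing the coin with tails is unlikely enough to pay for the increase of the potential in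
`pr_learn_le`. -/
lemma tails_queryCoin_mul_exp_le (q T u : ℕ) :
    (1 - heads (queryCoin q T u)) * Real.exp (T * heads (trial q u)) ≤ 1 := by
  rw [heads_queryCoin]
  have h1 := heads_le_one (trial q u)
  set p := heads (trial q u)
  have h2 : (1 - p) * Real.exp p ≤ 1 := by
    have := Real.add_one_le_exp (-p)
    calc (1 - p) * Real.exp p ≤ Real.exp (-p) * Real.exp p := by gcongr; linarith
      _ = 1 := by rw [← Real.exp_add]; simp
  calc (1 - (1 - (1 - p) ^ T)) * Real.exp (T * p) = ((1 - p) * Real.exp p) ^ T := by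
        rw [mul_pow, ← Real.exp_nat_mul]; ring
    _ ≤ 1 := pow_le_one₀ (mul_nonneg (by linarith) (Real.exp_pos _).le) h2

/-! ### The learner as a sequence of queries -/

/-- A labeled example. -/
abbrev Sample (d : ℕ) : Type := (Fin d → Bool) × Bool

/-- A literal fires on `x` if it has the truth value `f`. With `f = false` a conjunction, and with
`f = true` a disjunction, has the value `f` exactly if one of its literals fires. -/
def fires {d : ℕ} (f : Bool) (l : Literal d) (x : Fin d → Bool) : Bool := l.eval x == f

/-- The contribution of a database entry to the number of examples with label `f` on which the
literal `l` fires. Removed entries are `none`. -/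
def goodWeight {d : ℕ} (f : Bool) (l : Literal d) : Option (Sample d) → ℕ
  | none => 0
  | some z => if fires f l z.1 = true ∧ z.2 = f then 1 else 0

/-- The contribution of a database entry to the number of examples with label `!f` on which the
literal `l` fires. -/
def badWeight {d : ℕ} (f : Bool) (l : Literal d) : Option (Sample d) → ℕ
  | none => 0
  | some z => if fires f l z.1 = true ∧ z.2 ≠ f then 1 else 0

section Learner

variable {n d : ℕ}

/-- How far the literal `l` is from firing on at least `τ` examples with label `f` and on none with
label `!f`. -/
def deficit (f : Bool) (S : Fin n → Option (Sample d)) (τ : ℕ) (l : Literal d) : ℕ :=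
  (τ - ∑ i, goodWeight f l (S i)) + ∑ i, badWeight f l (S i)

/-- Remove all examples on which `l` fires. -/
def kill (f : Bool) (l : Literal d) (S : Fin n → Option (Sample d)) : Fin n → Option (Sample d) :=
  fun i => (S i).filter fun z => !fires f l z.1

/-- The learner. A query `(τ, l)` is decided by a coin whose bias depends on the deficit only. On
heads the literal `l` is selected, and the examples on which it fires are removed. -/
noncomputable def learn (f : Bool) (q T : ℕ) :
    List (ℕ × Literal d) → (Fin n → Option (Sample d)) → PMF (List (Literal d))
  | [], _ => PMF.pure []
  | (τ, l) :: Q, S => (queryCoin q T (deficit f S τ l)).bind fun b =>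
      if b then (learn f q T Q (kill f l S)).map (l :: ·) else learn f q T Q S

/-! ### Privacy -/

/-- Two databases that agree except that one entry may be missing in one of them. -/
def AddRemoveNeighbors (S S' : Fin n → Option (Sample d)) : Prop :=
  ∃ i, (S i = none ∨ S' i = none) ∧ ∀ j, j ≠ i → S j = S' j

lemma AddRemoveNeighbors.symm {S S' : Fin n → Option (Sample d)} (h : AddRemoveNeighbors S S') :
    AddRemoveNeighbors S' S := by
  obtain ⟨i, h1, h2⟩ := h
  exact ⟨i, h1.symm, fun j hj => (h2 j hj).symm⟩

/-- The entry in which neighbors differ is removed from both of them by the first selected literal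
that fires on it; the other literals do not see it. -/
lemma AddRemoveNeighbors.query (f : Bool) (τ : ℕ) (l : Literal d)
    {S S' : Fin n → Option (Sample d)} (h : AddRemoveNeighbors S S') :
    (deficit f S τ l = deficit f S' τ l ∧ AddRemoveNeighbors (kill f l S) (kill f l S')) ∨
    (deficit f S τ l ≤ deficit f S' τ l + 1 ∧ deficit f S' τ l ≤ deficit f S τ l + 1 ∧
      kill f l S = kill f l S') := by
  obtain ⟨i, h1, h2⟩ := h
  have hsum : ∀ w : Option (Sample d) → ℕ, ∃ r, ∑ j, w (S j) = w (S i) + r ∧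
      ∑ j, w (S' j) = w (S' i) + r := fun w => by
    refine ⟨∑ j ∈ Finset.univ.erase i, w (S j), ?_, ?_⟩
    · rw [Finset.add_sum_erase _ (fun j => w (S j)) (Finset.mem_univ i)]
    · rw [← Finset.add_sum_erase _ (fun j => w (S' j)) (Finset.mem_univ i)]
      congr 1
      exact Finset.sum_congr rfl fun j hj => by rw [h2 j (Finset.ne_of_mem_erase hj)]
  obtain ⟨r, hr, hr'⟩ := hsum (goodWeight f l)
  obtain ⟨s, hs, hs'⟩ := hsum (badWeight f l)
  unfold deficit
  rw [hr, hr', hs, hs']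
  have hkill : ∀ j, j ≠ i → kill f l S j = kill f l S' j := fun j hj => by
    simp only [kill, h2 j hj]
  have key : ∀ o : Option (Sample d),
      (goodWeight f l o = 0 ∧ badWeight f l o = 0) ∨
      (goodWeight f l o ≤ 1 ∧ badWeight f l o ≤ 1 ∧ goodWeight f l o + badWeight f l o ≤ 1 ∧
        o.filter (fun z => !fires f l z.1) = none) := by
    rintro (_ | z)
    · simp [goodWeight, badWeight]
    · by_cases hz : fires f l z.1 = true
      · right
        by_cases hf : z.2 = f <;> simp [goodWeight, badWeight, hz, hf]
      · left; simp [goodWeight, badWeight, hz]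
  rcases h1 with h1 | h1
  · rw [h1]
    have h0 : goodWeight f l (none : Option (Sample d)) = 0 := rfl
    have h0' : badWeight f l (none : Option (Sample d)) = 0 := rfl
    rw [h0, h0']
    rcases key (S' i) with ⟨ha, hb⟩ | ⟨ha, hb, hab, hc⟩
    · left
      refine ⟨by rw [ha, hb], i, Or.inl (by simp [kill, h1]), hkill⟩
    · right
      refine ⟨by omega, by omega, funext fun j => ?_⟩
      by_cases hj : j = i
      · subst hj; simp only [kill, h1, hc]; rfl
      · exact hkill j hj
  · rw [h1]
    have h0 : goodWeight f l (none : Option (Sample d)) = 0 := rfl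
    have h0' : badWeight f l (none : Option (Sample d)) = 0 := rfl
    rw [h0, h0']
    rcases key (S i) with ⟨ha, hb⟩ | ⟨ha, hb, hab, hc⟩
    · left
      refine ⟨by rw [ha, hb], i, Or.inr (by simp [kill, h1]), hkill⟩
    · right
      refine ⟨by omega, by omega, funext fun j => ?_⟩
      by_cases hj : j = i
      · subst hj; simp only [kill, h1, hc]; rfl
      · exact hkill j hj

/-- Privacy for one added or removed example, by induction on the queries. The allowance `b` for the
privacy loss is spent on tails in proportion to the probability of heads; the potential
`exp ((γ - b) / (2 γ))` bounds the probability that the differing example survives until the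
allowance is exhausted. -/
lemma pr_learn_le (f : Bool) {q : ℕ} (T : ℕ) (hq : 1 ≤ q)
    (Q : List (ℕ × Literal d)) :
    ∀ (S S' : Fin n → Option (Sample d)), AddRemoveNeighbors S S' → ∀ (A : Set (List (Literal d)))
      (b : ℝ), pr (learn f q T Q S) A ≤ Real.exp b * pr (learn f q T Q S') A +
        Real.exp ((2 * (1 / 2) ^ q - b) / (2 * (2 * (1 / 2) ^ q))) := by
  set γ : ℝ := 2 * (1 / 2) ^ q with hγ
  have hγ0 : 0 < γ := by positivity
  -- Below `γ` the potential is at least one.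
  have small : ∀ (μ ν : PMF (List (Literal d))) (A : Set (List (Literal d))) (b : ℝ), b ≤ γ →
      pr μ A ≤ Real.exp b * pr ν A + Real.exp ((γ - b) / (2 * γ)) := fun μ ν A b hb => by
    have h1 : 1 ≤ Real.exp ((γ - b) / (2 * γ)) :=
      Real.one_le_exp (div_nonneg (by linarith) (by linarith))
    have h2 := mul_nonneg (Real.exp_pos b).le (pr_nonneg ν A)
    linarith [pr_le_one μ A]
  induction Q with
  | nil =>
    intro S S' _ A b
    rcases le_total b γ with hb | hb
    · exact small _ _ A b hb
    · simp only [learn]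
      have h1 : 1 ≤ Real.exp b := Real.one_le_exp (by linarith)
      have h2 := Real.exp_pos ((γ - b) / (2 * γ))
      nlinarith [pr_nonneg (PMF.pure ([] : List (Literal d))) A]
  | cons head Q ih =>
    obtain ⟨τ, l⟩ := head
    intro S S' hSS' A b
    rcases le_total b γ with hb | hb
    · exact small _ _ A b hb
    simp only [learn, pr_bind_bool, if_true, Bool.false_eq_true, if_false, pr_map]
    rcases hSS'.query f τ l with ⟨hu, hk⟩ | ⟨hu, hu', hk⟩
    · rw [hu]
      set P := heads (queryCoin q T (deficit f S' τ l))
      have hP0 : 0 ≤ P := heads_nonneg _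
      have hP1 : P ≤ 1 := heads_le_one _
      have e1 := mul_le_mul_of_nonneg_left (ih _ _ hk ((l :: ·) ⁻¹' A) b) hP0
      have e2 := mul_le_mul_of_nonneg_left (ih _ _ hSS' A b) (by linarith : 0 ≤ 1 - P)
      nlinarith
    · rw [hk]
      have c1 := heads_queryCoin_le (T := T) hq hu'
      have c2 := tails_queryCoin_le (T := T) hq hu
      have c3 := tails_queryCoin_mul_exp_le q T (deficit f S τ l)
      rw [← hγ] at c1 c2
      set P := heads (queryCoin q T (deficit f S τ l))
      set P' := heads (queryCoin q T (deficit f S' τ l))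
      set w : ℝ := T * heads (trial q (deficit f S τ l))
      have hP'0 : 0 ≤ P' := heads_nonneg _
      have hP1 : P ≤ 1 := heads_le_one _
      have e2 := mul_le_mul_of_nonneg_left (ih _ _ hSS' A (b - 2 * γ * w))
        (by linarith : 0 ≤ 1 - P)
      have hb' : 1 + γ ≤ Real.exp b := by linarith [Real.add_one_le_exp b]
      set h := pr (learn f q T Q (kill f l S')) ((l :: ·) ⁻¹' A)
      set ν := pr (learn f q T Q S') A
      have hh : 0 ≤ h := pr_nonneg _ _
      have hν : 0 ≤ ν := pr_nonneg _ _
      have e1 : P * h ≤ Real.exp b * (P' * h) := by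
        calc P * h ≤ ((1 + γ) * P') * h := by gcongr
          _ ≤ (Real.exp b * P') * h := by gcongr
          _ = _ := by ring
      have e3 : (1 - P) * (Real.exp (b - 2 * γ * w) * ν) ≤ Real.exp b * ((1 - P') * ν) := by
        calc (1 - P) * (Real.exp (b - 2 * γ * w) * ν)
            ≤ ((1 - P') * Real.exp (2 * γ * w)) * (Real.exp (b - 2 * γ * w) * ν) := by gcongr
          _ = (1 - P') * (Real.exp (2 * γ * w) * Real.exp (b - 2 * γ * w)) * ν := by ring
          _ = _ := by rw [← Real.exp_add]; ring_nf
      have e4 : (1 - P) * Real.exp ((γ - (b - 2 * γ * w)) / (2 * γ)) ≤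
          Real.exp ((γ - b) / (2 * γ)) := by
        have : (γ - (b - 2 * γ * w)) / (2 * γ) = w + (γ - b) / (2 * γ) := by
          field_simp; ring
        rw [this, Real.exp_add, ← mul_assoc]
        exact mul_le_of_le_one_left (Real.exp_pos _).le c3
      nlinarith

/-- Privacy of the learner. Replacing an example amounts to removing one and adding another. -/
theorem isDifferentiallyPrivate_learn (f : Bool) {q : ℕ} (T : ℕ) (Q : List (ℕ × Literal d))
    {ε δ : ℝ} (hε : ε ∈ Set.Ioo (0 : ℝ) 1) (hδ : 0 < δ) (hq : 1 ≤ q)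
    (h : 8 * (1 / 2 + Real.log (4 / δ)) ≤ ε * 2 ^ q) :
    IsDifferentiallyPrivate ε δ fun S : Fin n → Sample d => learn f q T Q fun i => some (S i) := by
  rintro S S' ⟨i, hi⟩ A
  -- The common part of the two databases; each of the two steps may cost `ε / 2`.
  set S₀ : Fin n → Option (Sample d) := Function.update (fun i => some (S i)) i none
  have n1 : AddRemoveNeighbors (fun i => some (S i)) S₀ :=
    ⟨i, Or.inr (by simp [S₀]), fun j hj => by simp [S₀, hj]⟩
  have n2 : AddRemoveNeighbors S₀ (fun i => some (S' i)) :=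
    ⟨i, Or.inl (by simp [S₀]), fun j hj => by simp [S₀, hj, hi j hj]⟩
  have p1 := pr_learn_le f T hq Q _ _ n1 A (ε / 2)
  have p2 := pr_learn_le f T hq Q _ _ n2 A (ε / 2)
  have herr : Real.exp ((2 * (1 / 2) ^ q - ε / 2) / (2 * (2 * (1 / 2) ^ q))) ≤ δ / 4 := by
    have h1 : (2 * (1 / 2) ^ q - ε / 2) / (2 * (2 * (1 / 2) ^ q)) = 1 / 2 - ε * 2 ^ q / 8 := by
      have : (1 / 2 : ℝ) ^ q = 1 / 2 ^ q := by rw [div_pow, one_pow]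
      rw [this]; field_simp; ring
    rw [h1]
    calc Real.exp (1 / 2 - ε * 2 ^ q / 8) ≤ Real.exp (Real.log (δ / 4)) := by
          apply Real.exp_le_exp.2
          have : Real.log (4 / δ) = - Real.log (δ / 4) := by rw [← Real.log_inv, inv_div]
          rw [this] at h; linarith
      _ = δ / 4 := Real.exp_log (by linarith)
  have hexp : Real.exp (ε / 2) ≤ 3 := by
    calc Real.exp (ε / 2) ≤ Real.exp 1 := Real.exp_le_exp.2 (by linarith [hε.2])
      _ ≤ 3 := by linarith [Real.exp_one_lt_d9]
  have hsq : Real.exp ε = Real.exp (ε / 2) * Real.exp (ε / 2) := by rw [← Real.exp_add]; ring_nf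
  have main : pr (learn f q T Q fun i => some (S i)) A ≤
      Real.exp ε * pr (learn f q T Q fun i => some (S' i)) A + δ := by
    rw [hsq]
    have := mul_le_mul_of_nonneg_left p2 (Real.exp_pos (ε / 2)).le
    have := mul_le_mul_of_nonneg_left herr (Real.exp_pos (ε / 2)).le
    nlinarith
  calc _ = ENNReal.ofReal (pr (learn f q T Q fun i => some (S i)) A) := (ofReal_pr _ _).symm
    _ ≤ ENNReal.ofReal (Real.exp ε * pr (learn f q T Q fun i => some (S' i)) A + δ) :=
        ENNReal.ofReal_le_ofReal main
    _ = _ := by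
        rw [ENNReal.ofReal_add (mul_nonneg (Real.exp_pos _).le (pr_nonneg _ _)) hδ.le,
          ENNReal.ofReal_mul (Real.exp_pos _).le, ofReal_pr]

end Learner

/-! ### Typical runs -/

section Typical

variable {n d : ℕ}

/-- The typical outcomes of the learner: no literal of deficit `E` or more is selected, and no
literal of deficit zero is passed over. -/
inductive Typical (f : Bool) (E : ℕ) :
    List (ℕ × Literal d) → (Fin n → Option (Sample d)) → List (Literal d) → Prop
  | nil (S : Fin n → Option (Sample d)) : Typical f E [] S []
  | select {S : Fin n → Option (Sample d)} {τ : ℕ} {l : Literal d} {Q : List (ℕ × Literal d)}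
      {ψ : List (Literal d)} (hu : deficit f S τ l < E) (h : Typical f E Q (kill f l S) ψ) :
      Typical f E ((τ, l) :: Q) S (l :: ψ)
  | skip {S : Fin n → Option (Sample d)} {τ : ℕ} {l : Literal d} {Q : List (ℕ × Literal d)}
      {ψ : List (Literal d)} (hu : deficit f S τ l ≠ 0) (h : Typical f E Q S ψ) :
      Typical f E ((τ, l) :: Q) S ψ

lemma heads_queryCoin_le_of_le {q T E u : ℕ} (hu : E ≤ u) :
    heads (queryCoin q T u) ≤ T * Real.exp (-(E * (1 / 2) ^ q)) := by
  have hT := one_add_mul_le_pow (a := -heads (trial q u))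
    (by linarith [heads_le_one (trial q u)]) T
  have hy : (0 : ℝ) < (1 / 2) ^ q := by positivity
  have hy1 : (1 / 2 : ℝ) ^ q ≤ 1 := pow_le_one₀ (by norm_num) (by norm_num)
  have hp : heads (trial q u) ≤ Real.exp (-(E * (1 / 2) ^ q)) := by
    rw [heads_trial]
    have h1 : (1 - (1 / 2 : ℝ) ^ q) ^ u ≤ (1 - (1 / 2 : ℝ) ^ q) ^ E :=
      pow_le_pow_of_le_one (by linarith) (by linarith) hu
    have h2 : (1 - (1 / 2 : ℝ) ^ q) ^ E ≤ Real.exp (-(1 / 2) ^ q) ^ E :=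
      pow_le_pow_left₀ (by linarith) (by linarith [Real.add_one_le_exp (-(1 / 2 : ℝ) ^ q)]) E
    rw [← Real.exp_nat_mul, mul_neg] at h2
    have h3 : (0 : ℝ) ≤ (1 - (1 / 2 : ℝ) ^ q) ^ u := pow_nonneg (by linarith) _
    linarith
  have := mul_le_mul_of_nonneg_left hp (Nat.cast_nonneg (α := ℝ) T)
  rw [heads_queryCoin]
  rw [← sub_eq_add_neg] at hT
  linarith

lemma tails_queryCoin_zero (q T : ℕ) : 1 - heads (queryCoin q T 0) = (1 / 2) ^ T := by
  rw [heads_queryCoin, heads_trial]; norm_num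

/-- A union bound over the queries. -/
lemma pr_not_typical_le (f : Bool) {q T E : ℕ} {η : ℝ} (hE : 0 < E)
    (h1 : (1 / 2) ^ T ≤ η) (h2 : T * Real.exp (-(E * (1 / 2) ^ q)) ≤ η)
    (Q : List (ℕ × Literal d)) : ∀ S : Fin n → Option (Sample d),
    pr (learn f q T Q S) {ψ | ¬ Typical f E Q S ψ} ≤ Q.length * η := by
  induction Q with
  | nil =>
    intro S
    rw [learn, pr_pure_of_notMem (by simpa using Typical.nil S)]
    simp
  | cons head Q ih =>
    obtain ⟨τ, l⟩ := head
    intro S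
    simp only [learn, pr_bind_bool, if_true, Bool.false_eq_true, if_false, pr_map]
    set u := deficit f S τ l with hu
    have hP0 := heads_nonneg (queryCoin q T u)
    have hP1 := heads_le_one (queryCoin q T u)
    have hη : 0 ≤ η := le_trans (by positivity) h1
    have hlen : (((τ, l) :: Q).length : ℝ) = Q.length + 1 := by simp
    rw [hlen]
    have hQ : (0 : ℝ) ≤ Q.length * η := by positivity
    set A : Set (List (Literal d)) := (l :: ·) ⁻¹' {ψ | ¬ Typical f E ((τ, l) :: Q) S ψ} with hA
    set B : Set (List (Literal d)) := {ψ | ¬ Typical f E ((τ, l) :: Q) S ψ} with hB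
    have hA1 := pr_le_one (learn f q T Q (kill f l S)) A
    have hA0 := pr_nonneg (learn f q T Q (kill f l S)) A
    have hB1 := pr_le_one (learn f q T Q S) B
    have hB0 := pr_nonneg (learn f q T Q S) B
    have hA2 : u < E → pr (learn f q T Q (kill f l S)) A ≤ Q.length * η := fun h =>
      (pr_mono _ (A := A) (B := {ψ | ¬ Typical f E Q (kill f l S) ψ})
        fun ψ hψ ht =>
          (hψ : ¬ Typical f E ((τ, l) :: Q) S (l :: ψ)) (Typical.select h ht)).trans (ih (kill f l S))
    have hB2 : u ≠ 0 → pr (learn f q T Q S) B ≤ Q.length * η := fun h =>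
      (pr_mono _ (A := B) (B := {ψ | ¬ Typical f E Q S ψ})
        fun ψ hψ ht => (hψ : ¬ Typical f E ((τ, l) :: Q) S ψ) (Typical.skip h ht)).trans (ih S)
    rcases Nat.lt_or_ge u E with hlt | hge
    · by_cases h0 : u = 0
      · have ht := tails_queryCoin_zero q T
        rw [h0] at hP0 hP1 ⊢
        have := hA2 hlt
        rw [ht]
        nlinarith [mul_le_mul_of_nonneg_left hB1 (by positivity : (0 : ℝ) ≤ (1 / 2) ^ T)]
      · nlinarith [hA2 hlt, hB2 h0]
    · have hh := heads_queryCoin_le_of_le (q := q) (T := T) hge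
      nlinarith [hB2 (by omega)]

/-! ### Typical runs return accurate hypotheses -/

/-- Whether an entry is present and has the label `y`. -/
def labelWeight (y : Bool) : Option (Sample d) → ℕ
  | none => 0
  | some z => if z.2 = y then 1 else 0

/-- The number of remaining examples with label `y`. -/
def labelCount (y : Bool) (S : Fin n → Option (Sample d)) : ℕ := ∑ i, labelWeight y (S i)

/-- The number of remaining examples with label `f` on which `l` fires. -/
def goodCount (f : Bool) (l : Literal d) (S : Fin n → Option (Sample d)) : ℕ :=
  ∑ i, goodWeight f l (S i)

/-- The number of remaining examples with label `!f` on which `l` fires. -/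
def badCount (f : Bool) (l : Literal d) (S : Fin n → Option (Sample d)) : ℕ :=
  ∑ i, badWeight f l (S i)

/-- Remove all examples on which one of the literals in `ψ` fires. -/
def killAll (f : Bool) (ψ : List (Literal d)) (S : Fin n → Option (Sample d)) :
    Fin n → Option (Sample d) := ψ.foldl (fun S l => kill f l S) S

lemma killAll_append (f : Bool) (ψ ψ' : List (Literal d)) (S : Fin n → Option (Sample d)) :
    killAll f (ψ ++ ψ') S = killAll f ψ' (killAll f ψ S) := by
  simp [killAll]

lemma labelCount_kill_good (f : Bool) (l : Literal d) (S : Fin n → Option (Sample d)) :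
    labelCount f (kill f l S) + goodCount f l S = labelCount f S := by
  rw [labelCount, goodCount, labelCount, ← Finset.sum_add_distrib]
  refine Finset.sum_congr rfl fun i _ => ?_
  rcases h : S i with _ | z
  · simp [kill, h, labelWeight, goodWeight]
  · by_cases hz : fires f l z.1 = true <;>
      simp [kill, h, labelWeight, goodWeight, Option.filter, hz]

lemma labelCount_kill_bad (f : Bool) (l : Literal d) (S : Fin n → Option (Sample d)) :
    labelCount (!f) (kill f l S) + badCount f l S = labelCount (!f) S := by
  rw [labelCount, badCount, labelCount, ← Finset.sum_add_distrib]
  refine Finset.sum_congr rfl fun i _ => ?_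
  rcases h : S i with _ | z
  · simp [kill, h, labelWeight, badWeight]
  · by_cases hz : fires f l z.1 = true <;> rcases hy : z.2 <;> cases f <;>
      simp_all [kill, labelWeight, badWeight, Option.filter]

lemma goodCount_kill_le (f : Bool) (l l' : Literal d) (S : Fin n → Option (Sample d)) :
    goodCount f l' (kill f l S) ≤ goodCount f l' S := by
  refine Finset.sum_le_sum fun i _ => ?_
  rcases h : S i with _ | z
  · simp [kill, h, goodWeight]
  · by_cases hz : fires f l z.1 = true <;> simp [kill, h, goodWeight, Option.filter, hz]

lemma goodCount_kill_self (f : Bool) (l : Literal d) (S : Fin n → Option (Sample d)) :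
    goodCount f l (kill f l S) = 0 := by
  refine Finset.sum_eq_zero fun i _ => ?_
  rcases h : S i with _ | z
  · simp [kill, h, goodWeight]
  · by_cases hz : fires f l z.1 = true <;> simp [kill, h, goodWeight, Option.filter, hz]

lemma goodCount_killAll_le (f : Bool) (l' : Literal d) (ψ : List (Literal d)) :
    ∀ S : Fin n → Option (Sample d), goodCount f l' (killAll f ψ S) ≤ goodCount f l' S := by
  induction ψ with
  | nil => intro S; exact le_rfl
  | cons l ψ ih => intro S; exact (ih (kill f l S)).trans (goodCount_kill_le f l l' S)

/-- The remaining examples are labeled by the formula `φ`. -/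
def LabeledBy (f : Bool) (φ : List (Literal d)) (S : Fin n → Option (Sample d)) : Prop :=
  ∀ i z, S i = some z → (z.2 = f ↔ ∃ l ∈ φ, fires f l z.1 = true)

lemma LabeledBy.kill {f : Bool} {φ : List (Literal d)} {S : Fin n → Option (Sample d)}
    (h : LabeledBy f φ S) (l : Literal d) : LabeledBy f φ (kill f l S) := fun i z hz =>
  h i z (Option.eq_some_of_filter_eq_some hz)

lemma LabeledBy.killAll {f : Bool} {φ : List (Literal d)} (ψ : List (Literal d)) :
    ∀ {S : Fin n → Option (Sample d)}, LabeledBy f φ S → LabeledBy f φ (killAll f ψ S) := by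
  induction ψ with
  | nil => intro S h; exact h
  | cons l ψ ih => intro S h; exact ih (h.kill l)

/-- The literals of the target never fire on examples with label `!f`. -/
lemma LabeledBy.badCount_eq_zero {f : Bool} {φ : List (Literal d)} {S : Fin n → Option (Sample d)}
    (h : LabeledBy f φ S) {l : Literal d} (hl : l ∈ φ) : badCount f l S = 0 := by
  refine Finset.sum_eq_zero fun i _ => ?_
  rcases hi : S i with _ | z
  · rfl
  · have := h i z hi
    simp only [badWeight, ite_eq_right_iff, one_ne_zero, imp_false, not_and, not_not]
    exact fun hf => this.2 ⟨l, hl, hf⟩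

/-- The literals of the target cover the examples with label `f`. -/
lemma LabeledBy.labelCount_le {f : Bool} {φ : List (Literal d)} {S : Fin n → Option (Sample d)}
    (h : LabeledBy f φ S) : labelCount f S ≤ (φ.map fun l => goodCount f l S).sum := by
  have swap : ∀ φ : List (Literal d), (φ.map fun l => goodCount f l S).sum =
      ∑ i, (φ.map fun l => goodWeight f l (S i)).sum := fun φ => by
    induction φ with
    | nil => simp
    | cons l φ ih => rw [List.map_cons, List.sum_cons, ih]; simp [goodCount, Finset.sum_add_distrib]
  rw [swap]
  refine Finset.sum_le_sum fun i _ => ?_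
  rcases hi : S i with _ | z
  · simp [labelWeight]
  · by_cases hz : z.2 = f
    · obtain ⟨l, hl, hf⟩ := (h i z hi).1 hz
      have : goodWeight f l (some z) = 1 := by simp [goodWeight, hf, hz]
      simp only [labelWeight, hz, if_true]
      rw [← this]
      exact List.single_le_sum (by simp) _ (List.mem_map_of_mem hl)
    · simp [labelWeight, hz]

/-- One pass over the literals `ls` with the threshold `τ`: every selected literal fires on more than
`τ - E` examples with label `f` and on fewer than `E` with label `!f`, and afterwards the literals of
the target fire on fewer than `τ` examples with label `f`. -/
lemma Typical.pass {f : Bool} {E τ : ℕ} (hτ : 0 < τ) {Q : List (ℕ × Literal d)}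
    (ls : List (Literal d)) : ∀ {S : Fin n → Option (Sample d)} {ψ : List (Literal d)},
    Typical f E (ls.map (fun l => (τ, l)) ++ Q) S ψ →
    ∃ ψ₁ ψ₂, ψ = ψ₁ ++ ψ₂ ∧ Typical f E Q (killAll f ψ₁ S) ψ₂ ∧
      ψ₁.length * (τ - E) + labelCount f (killAll f ψ₁ S) ≤ labelCount f S ∧
      labelCount (!f) S ≤ labelCount (!f) (killAll f ψ₁ S) + ψ₁.length * E ∧
      ∀ φ, LabeledBy f φ S → ∀ l ∈ ls, l ∈ φ → goodCount f l (killAll f ψ₁ S) < τ := by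
  induction ls with
  | nil => intro S ψ h; exact ⟨[], ψ, rfl, h, by simp [killAll], by simp [killAll], by simp⟩
  | cons l ls ih =>
    intro S ψ h
    rw [List.map_cons, List.cons_append] at h
    cases h with
    | @select _ _ _ _ ψ' hu h =>
      obtain ⟨ψ₁, ψ₂, rfl, h₂, hg, hb, hl⟩ := ih h
      have hu' : τ - goodCount f l S + badCount f l S < E := hu
      have e1 := labelCount_kill_good f l S
      have e2 := labelCount_kill_bad f l S
      refine ⟨l :: ψ₁, ψ₂, rfl, h₂, ?_, ?_, ?_⟩
      · change (ψ₁.length + 1) * (τ - E) + labelCount f (killAll f ψ₁ (kill f l S)) ≤ _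
        rw [Nat.succ_mul]; omega
      · change _ ≤ labelCount (!f) (killAll f ψ₁ (kill f l S)) + (ψ₁.length + 1) * E
        rw [Nat.succ_mul]; omega
      · intro φ hφ l' hl' hl'φ
        change goodCount f l' (killAll f ψ₁ (kill f l S)) < τ
        rcases List.mem_cons.1 hl' with rfl | hl'
        · have := goodCount_killAll_le f l' ψ₁ (kill f l' S)
          rw [goodCount_kill_self] at this
          omega
        · exact hl φ (hφ.kill l) l' hl' hl'φ
    | skip hu h =>
      obtain ⟨ψ₁, ψ₂, rfl, h₂, hg, hb, hl⟩ := ih h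
      refine ⟨ψ₁, ψ₂, rfl, h₂, hg, hb, ?_⟩
      intro φ hφ l' hl' hl'φ
      rcases List.mem_cons.1 hl' with rfl | hl'
      · have hu' : τ - goodCount f l' S + badCount f l' S ≠ 0 := hu
        have := hφ.badCount_eq_zero hl'φ
        have := goodCount_killAll_le f l' ψ₁ S
        omega
      · exact hl φ hφ l' hl' hl'φ

/-- All literals over `d` variables. -/
def allLiterals (d : ℕ) : List (Literal d) :=
  (List.finRange d).flatMap fun i => [(i, false), (i, true)]

lemma mem_allLiterals (l : Literal d) : l ∈ allLiterals d := by
  obtain ⟨i, b⟩ := l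
  cases b <;> simp [allLiterals]

lemma length_allLiterals : (allLiterals d).length = 2 * d := by
  simp [allLiterals, List.length_flatMap, mul_comm]

/-- The queries of the learner: `J` passes over all literals, each with half the threshold of the
one before. -/
def schedule (d : ℕ) : ℕ → ℕ → List (ℕ × Literal d)
  | 0, _ => []
  | J + 1, τ => (allLiterals d).map (fun l => (τ / 2, l)) ++ schedule d J (τ / 2)

lemma length_schedule (J τ : ℕ) : (schedule d J τ).length = J * (2 * d) := by
  induction J generalizing τ with
  | zero => simp [schedule]
  | succ J ih => simp [schedule, ih, length_allLiterals]; ring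

/-- The set cover argument. After a pass with threshold `τ` fewer than `τ` of the remaining examples
belong to any one literal of the target, so the next pass cannot select many literals. -/
lemma Typical.schedule {f : Bool} {E k : ℕ} (hE : 0 < E) {φ : List (Literal d)}
    (hφ : φ.length ≤ k) (J : ℕ) :
    ∀ {τ : ℕ} {S : Fin n → Option (Sample d)} {ψ : List (Literal d)}, LabeledBy f φ S →
    labelCount f S ≤ k * τ → 2 * E ≤ τ / 2 ^ J → Typical f E (schedule d J τ) S ψ →
    ψ.length ≤ J * (5 * k) ∧ labelCount f (killAll f ψ S) ≤ k * (τ / 2 ^ J) ∧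
      labelCount (!f) S ≤ labelCount (!f) (killAll f ψ S) + ψ.length * E := by
  induction J with
  | zero =>
    intro τ S ψ _ hc _ h
    cases h
    exact ⟨by simp, by simpa [killAll] using hc, by simp [killAll]⟩
  | succ J ih =>
    intro τ S ψ hS hc hτ h
    have hdiv : τ / 2 ^ (J + 1) = τ / 2 / 2 ^ J := by rw [Nat.div_div_eq_div_mul, pow_succ']
    rw [hdiv] at hτ ⊢
    have hτ' : 2 * E ≤ τ / 2 := hτ.trans (Nat.div_le_self _ _)
    obtain ⟨ψ₁, ψ₂, rfl, h₂, hg, hb, hl⟩ := h.pass (by omega)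
    have hc' : labelCount f (killAll f ψ₁ S) ≤ k * (τ / 2) := by
      refine (hS.killAll ψ₁).labelCount_le.trans ?_
      have := List.sum_le_card_nsmul (φ.map fun l => goodCount f l (killAll f ψ₁ S)) (τ / 2)
        (by
          intro x hx
          obtain ⟨l, hlφ, rfl⟩ := List.mem_map.1 hx
          exact (hl φ hS l (mem_allLiterals l) hlφ).le)
      rw [List.length_map, smul_eq_mul] at this
      exact this.trans (Nat.mul_le_mul_right _ hφ)
    obtain ⟨i1, i2, i3⟩ := ih (hS.killAll ψ₁) hc' hτ h₂
    -- Each selection removes at least half of the threshold `τ / 2` from the `k τ` examples.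
    have hlen : ψ₁.length ≤ 5 * k := by
      have h1 : ψ₁.length * (τ / 2) ≤ ψ₁.length * (2 * (τ / 2 - E)) :=
        Nat.mul_le_mul_left _ (by omega)
      have h2 : k * τ ≤ k * (2 * (τ / 2) + 1) := Nat.mul_le_mul_left _ (by omega)
      have h3 : k * 2 ≤ k * (τ / 2) := Nat.mul_le_mul_left _ (by omega)
      have h4 : ψ₁.length * (τ / 2) ≤ 5 * k * (τ / 2) := by
        have h5 : ψ₁.length * (2 * (τ / 2 - E)) = 2 * (ψ₁.length * (τ / 2 - E)) := by ring
        have h6 : 5 * k * (τ / 2) = 5 * (k * (τ / 2)) := by ring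
        have h7 : k * (2 * (τ / 2) + 1) = 2 * (k * (τ / 2)) + k := by ring
        omega
      exact Nat.le_of_mul_le_mul_right h4 (by omega)
    rw [killAll_append, List.length_append]
    refine ⟨?_, i2, ?_⟩
    · rw [Nat.succ_mul]; omega
    · rw [Nat.add_mul]; omega

/-- The hypothesis represented by a list of literals: it has the value `f` where one of them
fires. -/
def hypothesis (f : Bool) (ψ : List (Literal d)) (x : Fin d → Bool) : Bool :=
  if ψ.any (fun l => fires f l x) then f else !f

lemma hypothesis_false (ψ : List (Literal d)) : hypothesis false ψ = conjEval ψ := by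
  ext x
  unfold hypothesis conjEval fires
  induction ψ with
  | nil => rfl
  | cons l ψ ih =>
    rw [List.any_cons, List.all_cons, ← ih]
    cases l.eval x <;> simp

lemma hypothesis_true (ψ : List (Literal d)) : hypothesis true ψ = disjEval ψ := by
  ext x
  unfold hypothesis disjEval fires
  induction ψ with
  | nil => rfl
  | cons l ψ ih =>
    rw [List.any_cons, List.any_cons, ← ih]
    cases l.eval x <;> simp

lemma killAll_apply (f : Bool) (ψ : List (Literal d)) :
    ∀ (S : Fin n → Option (Sample d)) (i : Fin n),
    killAll f ψ S i = (S i).filter fun z => !ψ.any fun l => fires f l z.1 := by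
  induction ψ with
  | nil => intro S i; rcases h : S i <;> simp [killAll, h, Option.filter]
  | cons l ψ ih =>
    intro S i
    change killAll f ψ (kill f l S) i = _
    rw [ih]
    rcases h : S i with _ | z
    · simp [kill, h]
    · by_cases hz : fires f l z.1 = true <;> simp [kill, h, hz, Option.filter]

/-- The number of examples on which the hypothesis `h` errs. -/
def errorCount (h : (Fin d → Bool) → Bool) (S : Fin n → Sample d) : ℕ :=
  ∑ i, if h (S i).1 ≠ (S i).2 then 1 else 0

/-- The errors are the surviving examples with label `f` and the removed ones with label `!f`. -/
lemma errorCount_hypothesis (f : Bool) (ψ : List (Literal d)) (S : Fin n → Sample d) :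
    errorCount (hypothesis f ψ) S + labelCount (!f) (killAll f ψ fun i => some (S i)) =
      labelCount f (killAll f ψ fun i => some (S i)) + labelCount (!f) fun i => some (S i) := by
  simp only [errorCount, labelCount, ← Finset.sum_add_distrib]
  refine Finset.sum_congr rfl fun i _ => ?_
  rw [killAll_apply]
  rcases hz : S i with ⟨x, y⟩
  cases ha : ψ.any (fun l => fires f l x) <;> cases y <;> cases f <;>
    simp [hypothesis, ha, Option.filter, labelWeight]

/-- On a typical run the output is short and nearly consistent with the sample. -/
theorem Typical.errorCount_le {f : Bool} {E k J : ℕ} (hE : 0 < E) (hk : 1 ≤ k)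
    {φ : List (Literal d)} (hφ : φ.length ≤ k) {x : Fin n → Fin d → Bool} {ψ : List (Literal d)}
    (hJ : 2 * E ≤ n / 2 ^ J)
    (h : Typical f E (PrivateLearning.schedule d J n)
      (fun i => some (x i, hypothesis f φ (x i))) ψ) :
    ψ.length ≤ J * (5 * k) ∧
      errorCount (hypothesis f ψ) (fun i => (x i, hypothesis f φ (x i))) ≤
        k * (n / 2 ^ J) + J * (5 * k) * E := by
  have hlab : LabeledBy f φ fun i => some (x i, hypothesis f φ (x i)) := by
    rintro i z hz
    obtain rfl := Option.some.inj hz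
    by_cases hany : ∃ l ∈ φ, fires f l (x i) = true
    · simp [hypothesis, hany]
    · simp [hypothesis, hany]
  have hcount : labelCount f (fun i => some (x i, hypothesis f φ (x i))) ≤ k * n := by
    calc _ ≤ ∑ _i : Fin n, 1 := Finset.sum_le_sum fun i _ => by
            simp only [labelWeight]; split_ifs <;> simp
      _ = n := by simp
      _ ≤ k * n := Nat.le_mul_of_pos_left _ hk
  obtain ⟨h1, h2, h3⟩ := h.schedule hE hφ J hlab hcount hJ
  have h4 := errorCount_hypothesis f ψ fun i => (x i, hypothesis f φ (x i))
  have h5 := Nat.mul_le_mul_right E h1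
  exact ⟨h1, by omega⟩

end Typical

/-! ### Generalization -/

section Generalization

variable {n d : ℕ}

/-- A Chernoff bound: a hypothesis of error more than `α` is unlikely to err on at most a fraction
`α / 4` of the sample. -/
lemma measure_errorCount_le (D : Measure (Fin d → Bool)) [IsProbabilityMeasure D] {α : ℝ}
    (hα : 0 < α) (c h : (Fin d → Bool) → Bool) (herr : ENNReal.ofReal α < genError D c h) (n : ℕ) :
    (Measure.pi fun _ : Fin n => D)
      {x | (errorCount h (fun i => (x i, c (x i))) : ℝ) ≤ α * n / 4} ≤
      ENNReal.ofReal (Real.exp (-(α * n / 3))) := by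
  set μ := Measure.pi fun _ : Fin n => D
  set g : (Fin d → Bool) → ℝ := fun x => if h x ≠ c x then Real.exp (-1) else 1 with hg
  set B : Set (Fin d → Bool) := {x | h x ≠ c x}
  have hprod : ∀ x : Fin n → Fin d → Bool,
      ∏ i, g (x i) = Real.exp (-(errorCount h (fun i => (x i, c (x i))) : ℝ)) := fun x => by
    rw [errorCount, Nat.cast_sum, ← Finset.sum_neg_distrib, Real.exp_sum]
    refine Finset.prod_congr rfl fun i _ => ?_
    by_cases hx : h (x i) = c (x i) <;> simp [hg, hx]
  have hB : α ≤ D.real B := by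
    have := (ENNReal.ofReal_lt_iff_lt_toReal hα.le (measure_ne_top D B)).1 herr
    exact this.le
  have he1 : Real.exp (-1) < 0.36788 := by
    have := Real.exp_neg_one_lt_d9
    linarith
  have hint : ∫ x, g x ∂D ≤ Real.exp (-(7 / 12 * α)) := by
    have h1 : ∀ x, g x = 1 - (1 - Real.exp (-1)) * B.indicator (fun _ => (1 : ℝ)) x := fun x => by
      by_cases hx : h x = c x <;> simp [hg, B, hx, Set.indicator]
    have h2 : ∫ x, g x ∂D = 1 - (1 - Real.exp (-1)) * D.real B := by
      simp_rw [h1]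
      rw [integral_sub Integrable.of_finite Integrable.of_finite, integral_const_mul,
        integral_indicator_const _ (Set.toFinite B).measurableSet]
      simp
    rw [h2]
    have h3 := Real.add_one_le_exp (-(7 / 12 * α))
    nlinarith
  have hI : ∫ x, ∏ i, g (x i) ∂μ = (∫ x, g x ∂D) ^ n := by
    rw [integral_fintype_prod_eq_pow]; simp
  have hg0 : 0 ≤ ∫ x, g x ∂D := integral_nonneg fun x => by
    simp only [hg, Pi.zero_apply]; split_ifs <;> positivity
  -- Markov's inequality for `exp (-errorCount)`, whose expectation factors over the sample.
  have hM := mul_meas_ge_le_integral_of_nonneg (μ := μ) (f := fun x => ∏ i, g (x i))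
    (Filter.Eventually.of_forall fun x => by
      exact (Real.exp_pos _).le.trans_eq (hprod x).symm)
    Integrable.of_finite (Real.exp (-(α * n / 4)))
  rw [hI] at hM
  have hset : {x | (errorCount h (fun i => (x i, c (x i))) : ℝ) ≤ α * n / 4} =
      {x : Fin n → Fin d → Bool | Real.exp (-(α * n / 4)) ≤ ∏ i, g (x i)} := by
    ext x
    simp only [Set.mem_ofPred_eq, hprod, Real.exp_le_exp, neg_le_neg_iff]
  rw [hset]
  have hpow : (∫ x, g x ∂D) ^ n ≤ Real.exp (-(7 / 12 * α)) ^ n := pow_le_pow_left₀ hg0 hint n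
  rw [← Real.exp_nat_mul] at hpow
  rw [ENNReal.le_ofReal_iff_toReal_le (measure_ne_top _ _) (Real.exp_pos _).le]
  change μ.real _ ≤ _
  have hfin : Real.exp (-(α * n / 4)) * Real.exp (-(α * n / 3)) =
      Real.exp (n * (-(7 / 12 * α))) := by
    rw [← Real.exp_add]; ring_nf
  exact le_of_mul_le_mul_left ((hM.trans hpow).trans_eq hfin.symm) (Real.exp_pos _)

/-- Every list of at most `L` literals is obtained from one of the `(2 d + 1) ^ L` sequences of `L`
optional literals. -/
def padded {L : ℕ} (s : Fin L → Option (Literal d)) : List (Literal d) :=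
  (List.ofFn s).reduceOption

lemma exists_padded {L : ℕ} {ψ : List (Literal d)} (h : ψ.length ≤ L) :
    ∃ s : Fin L → Option (Literal d), padded s = ψ := by
  refine ⟨fun i => ψ[(i : ℕ)]?, ?_⟩
  have : List.ofFn (fun i : Fin L => ψ[(i : ℕ)]?) =
      ψ.map some ++ List.replicate (L - ψ.length) none := by
    apply List.ext_getElem
    · simp; omega
    · intro i h1 h2
      rw [List.getElem_ofFn, List.getElem_append]
      split_ifs with hi
      · simp only [List.length_map] at hi
        simp [hi]
      · simp only [List.length_map] at hi
        simp [Nat.le_of_not_lt hi]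
  rw [padded, this, List.reduceOption_append]
  simp [List.reduceOption, List.filterMap_replicate_of_none]

/-- The probability that some short list of literals is inaccurate but looks accurate on the
sample. -/
lemma measure_exists_errorCount_le (f : Bool) (D : Measure (Fin d → Bool)) [IsProbabilityMeasure D]
    {α : ℝ} (hα : 0 < α) (c : (Fin d → Bool) → Bool) (n L : ℕ) :
    (Measure.pi fun _ : Fin n => D) {x | ∃ ψ : List (Literal d), ψ.length ≤ L ∧
        ENNReal.ofReal α < genError D c (hypothesis f ψ) ∧
        (errorCount (hypothesis f ψ) (fun i => (x i, c (x i))) : ℝ) ≤ α * n / 4} ≤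
      ENNReal.ofReal ((2 * d + 1) ^ L * Real.exp (-(α * n / 3))) := by
  set μ := Measure.pi fun _ : Fin n => D
  have hsub : {x : Fin n → Fin d → Bool | ∃ ψ : List (Literal d), ψ.length ≤ L ∧
        ENNReal.ofReal α < genError D c (hypothesis f ψ) ∧
        (errorCount (hypothesis f ψ) (fun i => (x i, c (x i))) : ℝ) ≤ α * n / 4} ⊆
      ⋃ s : Fin L → Option (Literal d),
        {x | ENNReal.ofReal α < genError D c (hypothesis f (padded s)) ∧
        (errorCount (hypothesis f (padded s)) (fun i => (x i, c (x i))) : ℝ) ≤ α * n / 4} := by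
    rintro x ⟨ψ, h1, h2, h3⟩
    obtain ⟨s, rfl⟩ := exists_padded h1
    exact Set.mem_iUnion.2 ⟨s, h2, h3⟩
  refine (measure_mono hsub).trans ((measure_iUnion_fintype_le μ _).trans ?_)
  calc _ ≤ ∑ _s : Fin L → Option (Literal d), ENNReal.ofReal (Real.exp (-(α * n / 3))) := by
        refine Finset.sum_le_sum fun s _ => ?_
        by_cases h : ENNReal.ofReal α < genError D c (hypothesis f (padded s))
        · simpa [h] using measure_errorCount_le D hα c _ h n
        · simp [h]
    _ = _ := by
        rw [Finset.sum_const, ENNReal.ofReal_mul (by positivity), nsmul_eq_mul]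
        congr 1
        rw [ENNReal.ofReal_pow (by positivity)]
        simp [Finset.card_univ]
        congr 1
        rw [ENNReal.ofReal_add (by positivity) (by positivity),
          ENNReal.ofReal_mul (by norm_num)]
        simp [mul_comm]

/-- An algorithm that is likely to return a short, nearly consistent list of literals on every
sample is a PAC learner, if the sample is large enough. -/
theorem isPACLearner_of_errorCount (f : Bool) {α β : ℝ} (hα : 0 < α) (hβ : 0 < β) {L k : ℕ}
    (A : (Fin n → Sample d) → PMF (List (Literal d)))
    (hA : ∀ (φ : List (Literal d)), φ.length ≤ k → ∀ x : Fin n → Fin d → Bool,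
      pr (A fun i => (x i, hypothesis f φ (x i)))
        {ψ | ¬ (ψ.length ≤ L ∧ (errorCount (hypothesis f ψ)
          (fun i => (x i, hypothesis f φ (x i))) : ℝ) ≤ α * n / 4)} ≤ β / 2)
    (hn : (2 * d + 1) ^ L * Real.exp (-(α * n / 3)) ≤ β / 2) :
    IsPACLearner α β {c | ∃ φ : List (Literal d), φ.length ≤ k ∧ c = hypothesis f φ}
      fun S => (A S).map (hypothesis f) := by
  rintro D hD c ⟨φ, hφ, rfl⟩
  set μ := Measure.pi fun _ : Fin n => D
  set Bad : Set (Fin n → Fin d → Bool) := {x | ∃ ψ : List (Literal d), ψ.length ≤ L ∧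
        ENNReal.ofReal α < genError D (hypothesis f φ) (hypothesis f ψ) ∧
        (errorCount (hypothesis f ψ) (fun i => (x i, hypothesis f φ (x i))) : ℝ) ≤ α * n / 4}
    with hBad
  have hbad : μ Bad ≤ ENNReal.ofReal (β / 2) :=
    (measure_exists_errorCount_le f D hα (hypothesis f φ) n L).trans (ENNReal.ofReal_le_ofReal hn)
  have hpt : ∀ x : Fin n → Fin d → Bool,
      ((A fun i => (x i, hypothesis f φ (x i))).map (hypothesis f)).toOuterMeasure
        {h | ENNReal.ofReal α < genError D (hypothesis f φ) h} ≤
      Bad.indicator 1 x + ENNReal.ofReal (β / 2) := fun x => by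
    by_cases hx : x ∈ Bad
    · rw [Set.indicator_of_mem hx]
      exact (toOuterMeasure_le_one _ _).trans le_self_add
    · rw [Set.indicator_of_notMem hx, zero_add, PMF.toOuterMeasure_map_apply, ← ofReal_pr]
      refine ENNReal.ofReal_le_ofReal ((pr_mono _ ?_).trans (hA φ hφ x))
      intro ψ hψ hgood
      exact hx ⟨ψ, hgood.1, hψ, hgood.2⟩
  calc _ ≤ ∫⁻ x, (Bad.indicator 1 x + ENNReal.ofReal (β / 2)) ∂μ := lintegral_mono hpt
    _ = μ Bad + ENNReal.ofReal (β / 2) := by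
        rw [lintegral_add_right _ measurable_const,
          lintegral_indicator_one (Set.toFinite Bad).measurableSet]
        simp
    _ ≤ ENNReal.ofReal (β / 2) + ENNReal.ofReal (β / 2) := by gcongr
    _ = ENNReal.ofReal β := by
        rw [← ENNReal.ofReal_add (by linarith) (by linarith)]; ring_nf

end Generalization

/-! ### The parameters of the learner -/

/-- The number of passes; `a` stands for `⌈1 / α⌉`. The last threshold is smaller than the sample
size by a factor between `8 k / α` and `64 k / α`. -/
def numPasses (k a : ℕ) : ℕ := k.size + a.size + 3

/-- The number of trials in a query; `a` and `b` stand for `⌈1 / α⌉` and `⌈1 / β⌉`. -/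
def numTrials (k d a b : ℕ) : ℕ := d.size + b.size + numPasses k a + 3

/-- The precision of the coins; `e` and `s` stand for `⌈1 / ε⌉` and `⌈1 / δ⌉`. Thus `2 ^ numBits e s`
is `log (2 / δ) / ε` up to a constant factor. -/
def numBits (e s : ℕ) : ℕ := e.size + s.size.size + 5

/-- Deficits of at least this value are unlikely to lead to a selection. -/
def deficitBound (k d a b e s : ℕ) : ℕ := 2 * 2 ^ numBits e s * numTrials k d a b

lemma deficitBound_pos (k d a b e s : ℕ) : 0 < deficitBound k d a b e s :=
  Nat.mul_pos (Nat.mul_pos two_pos (Nat.two_pow_pos _)) (by unfold numTrials; omega)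

section Bounds

lemma two_pow_size_le {x : ℕ} (hx : 1 ≤ x) : 2 ^ x.size ≤ 2 * x := by
  have h : 0 < x.size := Nat.size_pos.2 hx
  have : 2 ^ (x.size - 1) ≤ x := Nat.lt_size.1 (by omega)
  calc 2 ^ x.size = 2 * 2 ^ (x.size - 1) := by rw [← pow_succ']; congr 1; omega
    _ ≤ 2 * x := by omega

lemma le_two_pow_size (x : ℕ) : x ≤ 2 ^ x.size := (Nat.lt_size_self x).le

lemma two_pow_size_le_real {x : ℕ} (hx : 1 ≤ x) : (2 : ℝ) ^ x.size ≤ 2 * x := by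
  exact_mod_cast two_pow_size_le hx

lemma le_two_pow_size_real (x : ℕ) : (x : ℝ) ≤ 2 ^ x.size := by exact_mod_cast le_two_pow_size x

lemma size_mul_log_two_le {x : ℕ} (hx : 1 ≤ x) : (x.size : ℝ) * Real.log 2 ≤ Real.log (2 * x) := by
  rw [← Real.log_pow]
  exact Real.log_le_log (by positivity) (two_pow_size_le_real hx)

lemma le_of_mul_log_two_le {x B : ℝ} (hx : 0 ≤ x) (h : x * Real.log 2 ≤ B) : x ≤ 1.45 * B := by
  have h1 := mul_le_mul_of_nonneg_left Real.log_two_gt_d9.le hx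
  linarith

variable {γ : ℝ}

lemma one_le_ceil (h : γ ∈ Set.Ioo (0 : ℝ) 1) : 1 ≤ ⌈1 / γ⌉₊ :=
  Nat.one_le_ceil_iff.2 (one_div_pos.2 h.1)

lemma ceil_le (h : γ ∈ Set.Ioo (0 : ℝ) 1) : (⌈1 / γ⌉₊ : ℝ) ≤ 2 / γ := by
  have h1 : (⌈1 / γ⌉₊ : ℝ) < 1 / γ + 1 := Nat.ceil_lt_add_one (one_div_pos.2 h.1).le
  have h2 : 1 ≤ 1 / γ := (one_le_div h.1).2 h.2.le
  have h3 : 2 / γ = 1 / γ + 1 / γ := by ring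
  linarith

lemma le_ceil (γ : ℝ) : 1 / γ ≤ (⌈1 / γ⌉₊ : ℝ) := Nat.le_ceil _

/-- The precision of the coins suffices for privacy. -/
lemma le_mul_two_pow_numBits {ε δ : ℝ} (hε : ε ∈ Set.Ioo (0 : ℝ) 1) (hδ : δ ∈ Set.Ioo (0 : ℝ) 1) :
    8 * (1 / 2 + Real.log (4 / δ)) ≤ ε * 2 ^ numBits ⌈1 / ε⌉₊ ⌈1 / δ⌉₊ := by
  set e := ⌈1 / ε⌉₊
  set s := ⌈1 / δ⌉₊
  have he : 1 / ε ≤ 2 ^ e.size := (le_ceil ε).trans (le_two_pow_size_real e)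
  have hs : 1 / δ ≤ 2 ^ s.size := (le_ceil δ).trans (le_two_pow_size_real s)
  have hs1 : (1 : ℝ) ≤ s.size := by exact_mod_cast Nat.size_pos.2 (one_le_ceil hδ)
  have hss := le_two_pow_size_real s.size
  have hlog2 := Real.log_two_lt_d9
  have hlog : Real.log (4 / δ) ≤ 2 + s.size := by
    have h1 : Real.log (4 / δ) = 2 * Real.log 2 + Real.log (1 / δ) := by
      rw [div_eq_mul_one_div, Real.log_mul (by norm_num) (one_div_pos.2 hδ.1).ne',
        show (4 : ℝ) = 2 ^ 2 by norm_num, Real.log_pow]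
      norm_num
    have h2 : Real.log (1 / δ) ≤ s.size * Real.log 2 := by
      rw [← Real.log_pow]
      exact Real.log_le_log (one_div_pos.2 hδ.1) hs
    nlinarith
  have h1 : 1 ≤ ε * 2 ^ e.size := by
    have := mul_le_mul_of_nonneg_left he hε.1.le
    rwa [mul_one_div_cancel hε.1.ne'] at this
  have h2 : ε * 2 ^ numBits e s = (ε * 2 ^ e.size) * (2 ^ s.size.size * 32) := by
    rw [numBits, pow_add, pow_add]; norm_num; ring
  rw [h2]
  have h3 : (1 : ℝ) * (2 ^ s.size.size * 32) ≤ (ε * 2 ^ e.size) * (2 ^ s.size.size * 32) := by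
    gcongr
  linarith

/-- The number of trials is large enough for all queries to have the typical outcome. -/
lemma failure_le {k d a : ℕ} {β : ℝ} (hβ : β ∈ Set.Ioo (0 : ℝ) 1) (e s : ℕ) :
    ∃ η : ℝ, (1 / 2) ^ numTrials k d a ⌈1 / β⌉₊ ≤ η ∧
      numTrials k d a ⌈1 / β⌉₊ * Real.exp (-(deficitBound k d a ⌈1 / β⌉₊ e s *
        (1 / 2) ^ numBits e s)) ≤ η ∧
      ((numPasses k a * (2 * d) : ℕ) : ℝ) * η ≤ β / 2 := by
  set T := numTrials k d a ⌈1 / β⌉₊ with hT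
  refine ⟨(1 / 2) ^ T, le_rfl, ?_, ?_⟩
  · have h1 : (deficitBound k d a ⌈1 / β⌉₊ e s : ℝ) * (1 / 2) ^ numBits e s = T * 2 := by
      rw [deficitBound, ← hT]; push_cast
      have : (2 : ℝ) ^ numBits e s * (1 / 2) ^ numBits e s = 1 := by
        rw [← mul_pow]; norm_num
      linear_combination (2 * (T : ℝ)) * this
    rw [h1]
    have h2 : Real.exp (-(T * 2 : ℝ)) ≤ (1 / 2) ^ T * (1 / 2) ^ T := by
      have h3 : Real.exp (-(T * 2 : ℝ)) = Real.exp (-1) ^ T * Real.exp (-1) ^ T := by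
        rw [← Real.exp_nat_mul, ← Real.exp_add]; ring_nf
      have h4 : Real.exp (-1) ≤ 1 / 2 := by linarith [Real.exp_neg_one_lt_d9]
      have h5 := pow_le_pow_left₀ (Real.exp_pos _).le h4 T
      rw [h3]
      exact mul_le_mul h5 h5 (by positivity) (by positivity)
    have h6 : (T : ℝ) ≤ 2 ^ T := by exact_mod_cast Nat.lt_two_pow_self.le
    have h7 : (2 : ℝ) ^ T * (1 / 2) ^ T = 1 := by rw [← mul_pow]; norm_num
    have h8 : (0 : ℝ) < (1 / 2) ^ T := by positivity
    calc (T : ℝ) * Real.exp (-(T * 2 : ℝ)) ≤ 2 ^ T * ((1 / 2) ^ T * (1 / 2) ^ T) := by gcongr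
      _ = (1 / 2) ^ T := by rw [← mul_assoc, h7, one_mul]
  · have h1 : (numPasses k a : ℝ) ≤ 2 ^ numPasses k a := by exact_mod_cast Nat.lt_two_pow_self.le
    have h2 := le_two_pow_size_real d
    have h3 : 1 / β ≤ 2 ^ (⌈1 / β⌉₊).size := (le_ceil β).trans (le_two_pow_size_real _)
    have h4 : (2 : ℝ) ^ T = 2 ^ d.size * 2 ^ (⌈1 / β⌉₊).size * 2 ^ numPasses k a * 8 := by
      rw [hT, numTrials, pow_add, pow_add, pow_add]; norm_num
    have h5 : (numPasses k a : ℝ) * (2 * d) * (1 / β) * 4 ≤ 2 ^ T := by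
      rw [h4]
      have : (0 : ℝ) < 1 / β := one_div_pos.2 hβ.1
      calc (numPasses k a : ℝ) * (2 * d) * (1 / β) * 4
          ≤ 2 ^ numPasses k a * (2 * 2 ^ d.size) * 2 ^ (⌈1 / β⌉₊).size * 4 := by gcongr
        _ = _ := by ring
    have h6 : (1 / 2 : ℝ) ^ T = 1 / 2 ^ T := by rw [div_pow, one_pow]
    rw [h6, mul_one_div, div_le_iff₀ (by positivity)]
    push_cast
    have h7 := mul_le_mul_of_nonneg_left h5 hβ.1.le
    have h8 : β * ((numPasses k a : ℝ) * (2 * d) * (1 / β) * 4) =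
      numPasses k a * (2 * d) * 4 := by have := hβ.1.ne'; field_simp
    have h9 : (0 : ℝ) ≤ numPasses k a * (2 * d) := by positivity
    linarith

/-- Bounds on the parameters in terms of `ℓ = log d` and a common bound `Λ` for the logarithms of
the other quantities. -/
lemma parameter_bounds {k d : ℕ} {α β ε δ Λ : ℝ} (hk : 1 ≤ k) (hd : 2 ≤ d)
    (hα : α ∈ Set.Ioo (0 : ℝ) 1) (hβ : β ∈ Set.Ioo (0 : ℝ) 1) (hε : ε ∈ Set.Ioo (0 : ℝ) 1)
    (hδ : δ ∈ Set.Ioo (0 : ℝ) 1) (hΛ2 : Real.log 2 ≤ Λ) (hΛα : Real.log (k / α) ≤ Λ)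
    (hΛβ : Real.log (2 / β) ≤ Λ) (hΛδ : Real.log (2 / δ) ≤ Λ)
    {J E : ℕ} (hJ : J = numPasses k ⌈1 / α⌉₊)
    (hE : E = deficitBound k d ⌈1 / α⌉₊ ⌈1 / β⌉₊ ⌈1 / ε⌉₊ ⌈1 / δ⌉₊) :
    (2 : ℝ) ^ J ≤ 64 * (k / α) ∧ 8 * (k / α) ≤ (2 : ℝ) ^ J ∧ (J : ℝ) ≤ 11 * Λ ∧
      (E : ℝ) ≤ 51000 * (Real.log d * Λ ^ 2 / ε) := by
  obtain ⟨hα0, hα1⟩ := hα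
  obtain ⟨hβ0, hβ1⟩ := hβ
  obtain ⟨hε0, hε1⟩ := hε
  obtain ⟨hδ0, hδ1⟩ := hδ
  have hd' : (2 : ℝ) ≤ d := by exact_mod_cast hd
  have hl2 : 0.69 < Real.log 2 := by linarith [Real.log_two_gt_d9]
  have hℓ2 : Real.log 2 ≤ Real.log d := Real.log_le_log (by norm_num) hd'
  obtain ⟨ℓ, hℓ⟩ : ∃ ℓ, Real.log d = ℓ := ⟨_, rfl⟩
  rw [hℓ] at hℓ2 ⊢
  have hℓ0 : 0 < ℓ := by linarith
  have hΛ0 : 0 < Λ := by linarith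
  have ha := ceil_le (γ := α) ⟨hα0, hα1⟩
  have hJ2 : (2 : ℝ) ^ J = 2 ^ k.size * 2 ^ (⌈1 / α⌉₊).size * 8 := by
    rw [hJ, numPasses, pow_add, pow_add]; norm_num
  have hJle : (2 : ℝ) ^ J ≤ 64 * (k / α) := by
    rw [hJ2]
    calc (2 : ℝ) ^ k.size * 2 ^ (⌈1 / α⌉₊).size * 8 ≤ (2 * k) * (2 * (2 / α)) * 8 := by
          gcongr
          · exact two_pow_size_le_real hk
          · exact (two_pow_size_le_real (one_le_ceil ⟨hα0, hα1⟩)).trans (by linarith)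
      _ = 64 * (k / α) := by ring
  have hJge : 8 * (k / α) ≤ (2 : ℝ) ^ J := by
    rw [hJ2]
    calc 8 * (k / α) = k * (1 / α) * 8 := by ring
      _ ≤ _ := by
        gcongr
        · exact le_two_pow_size_real k
        · exact (le_ceil α).trans (le_two_pow_size_real _)
  have hJΛ : (J : ℝ) ≤ 11 * Λ := by
    have h1 : (J : ℝ) * Real.log 2 ≤ Real.log (64 * (k / α)) := by
      rw [← Real.log_pow]; exact Real.log_le_log (by positivity) hJle
    rw [Real.log_mul (by norm_num) (by positivity), show (64 : ℝ) = 2 ^ 6 by norm_num,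
      Real.log_pow] at h1
    push_cast at h1
    linarith [le_of_mul_log_two_le (Nat.cast_nonneg _) h1]
  have hq : (2 : ℝ) ^ numBits ⌈1 / ε⌉₊ ⌈1 / δ⌉₊ ≤ 768 * (Λ / ε) := by
    have hs : ((⌈1 / δ⌉₊).size : ℝ) ≤ 3 * Λ := by
      have h1 := size_mul_log_two_le (one_le_ceil (γ := δ) ⟨hδ0, hδ1⟩)
      have h2 : Real.log (2 * (⌈1 / δ⌉₊ : ℝ)) ≤ Real.log (2 * (2 / δ)) :=
        Real.log_le_log (by have := one_le_ceil (γ := δ) ⟨hδ0, hδ1⟩; positivity)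
          (by linarith [ceil_le (γ := δ) ⟨hδ0, hδ1⟩])
      rw [Real.log_mul (x := 2) (by norm_num) (by positivity : 2 / δ ≠ 0)] at h2
      linarith [le_of_mul_log_two_le (Nat.cast_nonneg _) (h1.trans h2)]
    have h3 : 1 ≤ (⌈1 / δ⌉₊).size := Nat.size_pos.2 (one_le_ceil ⟨hδ0, hδ1⟩)
    calc (2 : ℝ) ^ numBits ⌈1 / ε⌉₊ ⌈1 / δ⌉₊
        = 2 ^ (⌈1 / ε⌉₊).size * 2 ^ (⌈1 / δ⌉₊).size.size * 32 := by
          rw [numBits, pow_add, pow_add]; norm_num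
      _ ≤ (2 * (2 / ε)) * (2 * (3 * Λ)) * 32 := by
          gcongr
          · exact (two_pow_size_le_real (one_le_ceil ⟨hε0, hε1⟩)).trans
              (by linarith [ceil_le (γ := ε) ⟨hε0, hε1⟩])
          · exact (two_pow_size_le_real h3).trans (by linarith)
      _ = 768 * (Λ / ε) := by ring
  have hT : (numTrials k d ⌈1 / α⌉₊ ⌈1 / β⌉₊ : ℝ) ≤ 33 * (ℓ * Λ) := by
    have hb : ((⌈1 / β⌉₊).size : ℝ) ≤ 3 * Λ := by
      have h1 := size_mul_log_two_le (one_le_ceil (γ := β) ⟨hβ0, hβ1⟩)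
      have h2 : Real.log (2 * (⌈1 / β⌉₊ : ℝ)) ≤ Real.log (2 * (2 / β)) :=
        Real.log_le_log (by have := one_le_ceil (γ := β) ⟨hβ0, hβ1⟩; positivity)
          (by linarith [ceil_le (γ := β) ⟨hβ0, hβ1⟩])
      rw [Real.log_mul (x := 2) (by norm_num) (by positivity : 2 / β ≠ 0)] at h2
      linarith [le_of_mul_log_two_le (Nat.cast_nonneg _) (h1.trans h2)]
    have hds : (d.size : ℝ) ≤ 3 * ℓ := by
      have h1 := size_mul_log_two_le (by omega : 1 ≤ d)
      rw [Real.log_mul (by norm_num) (by positivity), hℓ] at h1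
      linarith [le_of_mul_log_two_le (Nat.cast_nonneg _) h1]
    rw [numTrials, ← hJ]; push_cast
    have h1 : ℓ ≤ 1.45 * (ℓ * Λ) := le_of_mul_log_two_le hℓ0.le (by gcongr)
    have h2 : Λ ≤ 1.45 * (ℓ * Λ) := le_of_mul_log_two_le hΛ0.le (by
      rw [mul_comm]; gcongr)
    have h3 : 1 ≤ 1.45 * Λ := le_of_mul_log_two_le zero_le_one (by linarith)
    linarith
  have hE' : (E : ℝ) ≤ 51000 * (ℓ * Λ ^ 2 / ε) := by
    rw [hE, deficitBound]; push_cast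
    have h1 := mul_le_mul hq hT (Nat.cast_nonneg _) (by positivity)
    have h2 : 768 * (Λ / ε) * (33 * (ℓ * Λ)) = 25344 * (ℓ * Λ ^ 2 / ε) := by ring
    have h3 : 0 ≤ ℓ * Λ ^ 2 / ε := by positivity
    linarith
  exact ⟨hJle, hJge, hJΛ, hE'⟩

/-- The three conditions on the sample size. -/
lemma sampleSize_bounds {k d n : ℕ} {α β ε δ : ℝ} (hk : 1 ≤ k) (hd : 2 ≤ d)
    (hα : α ∈ Set.Ioo (0 : ℝ) 1) (hβ : β ∈ Set.Ioo (0 : ℝ) 1) (hε : ε ∈ Set.Ioo (0 : ℝ) 1)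
    (hδ : δ ∈ Set.Ioo (0 : ℝ) 1)
    (hn : 30000000 * (1 / (α * ε) * (k : ℝ) * Real.log d) *
      Real.log (2 * k / (α * β * ε * δ)) ^ 3 ≤ n)
    {J E : ℕ} (hJ : J = numPasses k ⌈1 / α⌉₊)
    (hE : E = deficitBound k d ⌈1 / α⌉₊ ⌈1 / β⌉₊ ⌈1 / ε⌉₊ ⌈1 / δ⌉₊) :
    2 * E ≤ n / 2 ^ J ∧ ((k * (n / 2 ^ J) + J * (5 * k) * E : ℕ) : ℝ) ≤ α * n / 4 ∧
      (2 * d + 1) ^ (J * (5 * k)) * Real.exp (-(α * n / 3)) ≤ β / 2 := by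
  revert hn
  obtain ⟨hα0, hα1⟩ := hα
  obtain ⟨hβ0, hβ1⟩ := hβ
  obtain ⟨hε0, hε1⟩ := hε
  obtain ⟨hδ0, hδ1⟩ := hδ
  have hk' : (1 : ℝ) ≤ k := by exact_mod_cast hk
  have hd' : (2 : ℝ) ≤ d := by exact_mod_cast hd
  obtain ⟨ℓ, hℓ⟩ : ∃ ℓ, Real.log d = ℓ := ⟨_, rfl⟩
  obtain ⟨Λ, hΛ⟩ : ∃ Λ, Real.log (2 * k / (α * β * ε * δ)) = Λ := ⟨_, rfl⟩
  rw [hℓ, hΛ]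
  have hl2 : 0.69 < Real.log 2 := by linarith [Real.log_two_gt_d9]
  have hl2' : Real.log 2 < 0.7 := by linarith [Real.log_two_lt_d9]
  have hℓ2 : Real.log 2 ≤ ℓ := hℓ ▸ Real.log_le_log (by norm_num) hd'
  have hprod : 0 < α * β * ε * δ := by positivity
  -- `Λ` dominates the logarithm of every quantity `x` below.
  have hle : ∀ x : ℝ, 0 < x → x * (α * β * ε * δ) ≤ 2 * k → Real.log x ≤ Λ := fun x hx h => hΛ ▸
    Real.log_le_log hx ((le_div_iff₀ hprod).2 h)
  have m1 : β * ε * δ ≤ 1 := mul_le_one₀ (mul_le_one₀ hβ1.le hε0.le hε1.le) hδ0.le hδ1.le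
  have m2 : α * β * ε * δ ≤ 1 := mul_le_one₀
    (mul_le_one₀ (mul_le_one₀ hα1.le hβ0.le hβ1.le) hε0.le hε1.le) hδ0.le hδ1.le
  have m3 : α * ε * δ ≤ 1 := mul_le_one₀ (mul_le_one₀ hα1.le hε0.le hε1.le) hδ0.le hδ1.le
  have m4 : α * β * ε ≤ 1 := mul_le_one₀ (mul_le_one₀ hα1.le hβ0.le hβ1.le) hε0.le hε1.le
  have hΛ2 : Real.log 2 ≤ Λ := hle 2 (by norm_num) (by linarith)
  have hΛα : Real.log (k / α) ≤ Λ := hle _ (by positivity) (by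
    have : k / α * (α * β * ε * δ) = k * (β * ε * δ) := by field_simp
    rw [this]; linarith [mul_le_of_le_one_right (by linarith : (0 : ℝ) ≤ k) m1])
  have hΛβ : Real.log (2 / β) ≤ Λ := hle _ (by positivity) (by
    have : 2 / β * (α * β * ε * δ) = 2 * (α * ε * δ) := by field_simp
    rw [this]; linarith)
  have hΛδ : Real.log (2 / δ) ≤ Λ := hle _ (by positivity) (by
    have : 2 / δ * (α * β * ε * δ) = 2 * (α * β * ε) := by field_simp
    rw [this]; linarith)
  have hℓ0 : 0 < ℓ := by linarith
  have hΛ0 : 0 < Λ := by linarith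
  obtain ⟨hJle, hJge, hJΛ, hE'⟩ := parameter_bounds hk hd ⟨hα0, hα1⟩ ⟨hβ0, hβ1⟩ ⟨hε0, hε1⟩
    ⟨hδ0, hδ1⟩ hΛ2 hΛα hΛβ hΛδ hJ hE
  rw [hℓ] at hE'
  clear hJ hE hΛα hΛδ hle m1 m2 m3 m4 hprod
  have hΛ3 : Λ ^ 2 ≤ 3 / 2 * Λ ^ 3 := by
    have : 0 ≤ Λ ^ 2 * (3 / 2 * Λ - 1) := mul_nonneg (by positivity) (by linarith)
    linarith
  intro hn
  obtain ⟨Z, hZ⟩ : ∃ Z, Z = 1 / (α * ε) * (k : ℝ) * ℓ * Λ ^ 3 := ⟨_, rfl⟩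
  have hZ0 : 0 < Z := by rw [hZ]; positivity
  have hnZ : 30000000 * Z ≤ n := by rw [hZ]; linarith
  have hαZ : α * Z = k * ℓ * Λ ^ 3 / ε := by rw [hZ]; field_simp
  refine ⟨?_, ?_, ?_⟩
  · rw [Nat.le_div_iff_mul_le (by positivity)]
    have : ((2 * E * 2 ^ J : ℕ) : ℝ) ≤ n := by
      push_cast
      calc 2 * (E : ℝ) * 2 ^ J
          ≤ 2 * (51000 * (ℓ * (3 / 2 * Λ ^ 3) / ε)) * (64 * (k / α)) := by
            gcongr
            exact hE'.trans (by gcongr)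
        _ = 9792000 * Z := by rw [hZ]; field_simp; norm_num
        _ ≤ n := by linarith
    exact_mod_cast this
  · have h1 : (k : ℝ) * ((n / 2 ^ J : ℕ) : ℝ) ≤ α * n / 8 := by
      calc (k : ℝ) * ((n / 2 ^ J : ℕ) : ℝ) ≤ k * (n / 2 ^ J) := by
            gcongr; exact_mod_cast Nat.cast_div_le (α := ℝ) (m := n) (n := 2 ^ J)
        _ ≤ k * (n / (8 * (k / α))) := by gcongr
        _ = α * n / 8 := by field_simp
    have h2 : (J : ℝ) * (5 * k) * E ≤ α * n / 8 := by
      calc (J : ℝ) * (5 * k) * E ≤ 11 * Λ * (5 * k) * (51000 * (ℓ * Λ ^ 2 / ε)) := by gcongr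
        _ = 2805000 * (α * Z) := by rw [hαZ]; ring
        _ ≤ α * n / 8 := by linarith [mul_le_mul_of_nonneg_left hnZ hα0.le, mul_pos hα0 hZ0]
    push_cast
    linarith
  · have h1 : Real.log (2 * d + 1) ≤ 3 * ℓ := by
      have : Real.log ((d : ℝ) ^ 3) = 3 * ℓ := by rw [Real.log_pow, hℓ]; norm_num
      rw [← this]
      exact Real.log_le_log (by positivity) (by
        have h3 := mul_nonneg (mul_nonneg (sub_nonneg.2 hd') (sub_nonneg.2 hd'))
          (by linarith : (0 : ℝ) ≤ d)
        nlinarith only [h3, hd'])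
    have h2 : ((J * (5 * k) : ℕ) : ℝ) * Real.log (2 * d + 1) + Real.log (2 / β) ≤ α * n / 3 := by
      push_cast
      have hone : 1 ≤ 3 / 2 * Λ := by linarith
      have hone' : 1 ≤ 3 / 2 * ℓ := by linarith
      have hZ1 : k * ℓ * Λ ^ 3 ≤ α * Z := by
        rw [hαZ, le_div_iff₀ hε0]
        exact mul_le_of_le_one_right (by positivity) hε1.le
      have hsq : Λ ≤ 9 / 4 * Λ ^ 3 := by linarith [mul_nonneg hΛ0.le (sub_nonneg.2 hone)]
      have hkl : k * ℓ * Λ ≤ 9 / 4 * (k * ℓ * Λ ^ 3) := by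
        have := mul_le_mul_of_nonneg_left hsq (by positivity : 0 ≤ k * ℓ); linarith
      have hlam : Λ ≤ 3 / 2 * (k * ℓ * Λ) := by
        have h3 : 1 ≤ 3 / 2 * (k * ℓ) := by
          linarith [mul_le_mul_of_nonneg_right hk' hℓ0.le]
        linarith [mul_nonneg (sub_nonneg.2 h3) hΛ0.le]
      calc (J : ℝ) * (5 * k) * Real.log (2 * d + 1) + Real.log (2 / β)
          ≤ 11 * Λ * (5 * k) * (3 * ℓ) + Λ := by
            have : 0 ≤ Real.log (2 * (d : ℝ) + 1) := Real.log_nonneg (by linarith)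
            gcongr
        _ = 165 * (k * ℓ * Λ) + Λ := by ring
        _ ≤ 1000 * (α * Z) := by linarith
        _ ≤ α * n / 3 := by linarith [mul_le_mul_of_nonneg_left hnZ hα0.le, mul_pos hα0 hZ0]
    have h3 : ((2 : ℝ) * d + 1) ^ (J * (5 * k)) =
        Real.exp (((J * (5 * k) : ℕ) : ℝ) * Real.log (2 * d + 1)) := by
      rw [← Real.log_pow, Real.exp_log (by positivity)]
    rw [h3, ← Real.exp_add]
    have h4 : β / 2 = Real.exp (- Real.log (2 / β)) := by
      rw [← Real.log_inv, inv_div, Real.exp_log (by positivity)]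
    rw [h4]
    exact Real.exp_le_exp.2 (by linarith)

end Bounds

/-! ### Reasoning about programs -/

/-- From the configuration `s` the machine always halts within `t` steps, with output law `μ`.
Specifications of program fragments take the form: if every configuration that may be reached
satisfies `Halts t` with a suitable output law, then the initial configuration satisfies
`Halts (t + c)`, where `c` bounds the number of steps of the fragment. In the proofs the step counts
of the single commands are therefore summed from the last command to the first. -/
def Halts (t : ℕ) (s : Config) (μ : PMF (List ℕ)) : Prop :=
  ∀ t', t ≤ t' → (Config.run t' s).map Config.result = μ.map some

/-- The registers below `b` have the same contents in `r` and `r'`. Fragments keep their scratch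
registers above those of the fragments that call them, so this describes what they preserve. -/
def Agree (b : ℕ) (r r' : ℕ → ℕ) : Prop := ∀ y, y < b → r' y = r y

lemma Agree.refl (b : ℕ) (r : ℕ → ℕ) : Agree b r r := fun _ _ => rfl

lemma Agree.trans {b : ℕ} {r r' r'' : ℕ → ℕ} (h : Agree b r r') (h' : Agree b r' r'') :
    Agree b r r'' := fun y hy => (h' y hy).trans (h y hy)

lemma Agree.mono {b b' : ℕ} {r r' : ℕ → ℕ} (h : Agree b r r') (hb : b' ≤ b) : Agree b' r r' :=
  fun y hy => h y (hy.trans_le hb)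

lemma agree_update {b x v : ℕ} {r r' : ℕ → ℕ} (hx : b ≤ x) :
    Agree b r (Function.update r' x v) ↔ Agree b r r' := by
  refine forall₂_congr fun y hy => ?_
  rw [Function.update_of_ne (by omega)]

section Logic

variable {t c : ℕ} {K ps : List Program} {r mem : ℕ → ℕ} {o : List ℕ} {μ : PMF (List ℕ)}

lemma Halts.mono {t' : ℕ} {s : Config} (h : Halts t s μ) (ht : t ≤ t') : Halts t' s μ :=
  fun t'' h'' => h t'' (ht.trans h'')

lemma halts_nil (r mem : ℕ → ℕ) (o : List ℕ) : Halts 0 ⟨[], r, mem, o⟩ (PMF.pure o) := by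
  intro t' _
  have : Config.run t' ⟨[], r, mem, o⟩ = PMF.pure ⟨[], r, mem, o⟩ := by
    induction t' with
    | zero => rfl
    | succ t' ih => simp [Config.run, Config.step, ih]
  rw [this, PMF.pure_map, PMF.pure_map]
  rfl

lemma Halts.of_step {s s' : Config} (hs : s.step = PMF.pure s') (h : Halts t s' μ) :
    Halts (t + 1) s μ := by
  intro t' ht'
  obtain ⟨t', rfl⟩ : ∃ u, t' = u + 1 := ⟨t' - 1, by omega⟩
  rw [Config.run, hs, PMF.pure_bind]
  exact h t' (by omega)

lemma Halts.skip (h : Halts t ⟨K, r, mem, o⟩ μ) : Halts (t + 1) ⟨.skip :: K, r, mem, o⟩ μ :=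
  h.of_step rfl

lemma Halts.const {x v : ℕ} (h : Halts t ⟨K, Function.update r x v, mem, o⟩ μ) :
    Halts (t + 1) ⟨.const x v :: K, r, mem, o⟩ μ := h.of_step rfl

lemma Halts.copy {x y : ℕ} (h : Halts t ⟨K, Function.update r x (r y), mem, o⟩ μ) :
    Halts (t + 1) ⟨.copy x y :: K, r, mem, o⟩ μ := h.of_step rfl

lemma Halts.add {x y z : ℕ} (h : Halts t ⟨K, Function.update r x (r y + r z), mem, o⟩ μ) :
    Halts (t + 1) ⟨.add x y z :: K, r, mem, o⟩ μ := h.of_step rfl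

lemma Halts.sub {x y z : ℕ} (h : Halts t ⟨K, Function.update r x (r y - r z), mem, o⟩ μ) :
    Halts (t + 1) ⟨.sub x y z :: K, r, mem, o⟩ μ := h.of_step rfl

lemma Halts.half {x y : ℕ} (h : Halts t ⟨K, Function.update r x (r y / 2), mem, o⟩ μ) :
    Halts (t + 1) ⟨.half x y :: K, r, mem, o⟩ μ := h.of_step rfl

lemma Halts.load {x y : ℕ} (h : Halts t ⟨K, Function.update r x (mem (r y)), mem, o⟩ μ) :
    Halts (t + 1) ⟨.load x y :: K, r, mem, o⟩ μ := h.of_step rfl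

lemma Halts.store {x y : ℕ} (h : Halts t ⟨K, r, Function.update mem (r x) (r y), o⟩ μ) :
    Halts (t + 1) ⟨.store x y :: K, r, mem, o⟩ μ := h.of_step rfl

lemma Halts.emit {x : ℕ} (h : Halts t ⟨K, r, mem, o ++ [r x]⟩ μ) :
    Halts (t + 1) ⟨.emit x :: K, r, mem, o⟩ μ := h.of_step rfl

lemma Halts.seq {p q : Program} (h : Halts t ⟨p :: q :: K, r, mem, o⟩ μ) :
    Halts (t + 1) ⟨.seq p q :: K, r, mem, o⟩ μ := h.of_step rfl

lemma Halts.cond_pos {x : ℕ} {p q : Program} (hx : r x ≠ 0) (h : Halts t ⟨p :: K, r, mem, o⟩ μ) :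
    Halts (t + 1) ⟨.cond x p q :: K, r, mem, o⟩ μ := h.of_step (by simp [Config.step, hx])

lemma Halts.cond_neg {x : ℕ} {p q : Program} (hx : r x = 0) (h : Halts t ⟨q :: K, r, mem, o⟩ μ) :
    Halts (t + 1) ⟨.cond x p q :: K, r, mem, o⟩ μ := h.of_step (by simp [Config.step, hx])

lemma Halts.flip {x : ℕ} {μ : Bool → PMF (List ℕ)}
    (h : ∀ b : Bool, Halts t ⟨K, Function.update r x b.toNat, mem, o⟩ (μ b)) :
    Halts (t + 1) ⟨.flip x :: K, r, mem, o⟩ (fairCoin.bind μ) := by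
  intro t' ht'
  obtain ⟨t', rfl⟩ : ∃ u, t' = u + 1 := ⟨t' - 1, by omega⟩
  simp only [Config.run, Config.step, PMF.bind_map, PMF.map_bind]
  refine congrArg _ (funext fun b => ?_)
  exact h b t' (by omega)

/-- The sequential composition of a list of programs. -/
def block : List Program → Program
  | [] => .skip
  | p :: ps => .seq p (block ps)

lemma Halts.block_nil (h : Halts t ⟨K, r, mem, o⟩ μ) :
    Halts (t + 1) ⟨block [] :: K, r, mem, o⟩ μ := h.skip

lemma Halts.block_cons {p : Program} (h : Halts t ⟨p :: block ps :: K, r, mem, o⟩ μ) :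
    Halts (t + 1) ⟨block (p :: ps) :: K, r, mem, o⟩ μ := h.seq

/-- Invariant rule for loops: `P m` relates the states in which `m` iterations remain to the output
laws that are to be produced from them. -/
lemma Halts.loop {x : ℕ} {p : Program}
    (P : ℕ → (ℕ → ℕ) → (ℕ → ℕ) → List ℕ → PMF (List ℕ) → Prop)
    (hzero : ∀ r mem o μ, P 0 r mem o μ → r x = 0 ∧ Halts t ⟨K, r, mem, o⟩ μ)
    (hsucc : ∀ m r mem o μ t', P (m + 1) r mem o μ → r x ≠ 0 ∧
      ((∀ r' mem' o' μ', P m r' mem' o' μ' → Halts t' ⟨.loop x p :: K, r', mem', o'⟩ μ') →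
        Halts (t' + c) ⟨p :: .loop x p :: K, r, mem, o⟩ μ))
    (m : ℕ) : ∀ {r mem o μ}, P m r mem o μ →
      Halts (t + m * (c + 1) + 1) ⟨.loop x p :: K, r, mem, o⟩ μ := by
  induction m with
  | zero =>
    intro r mem o μ h
    obtain ⟨h1, h2⟩ := hzero r mem o μ h
    exact (h2.of_step (by simp [Config.step, h1])).mono (by omega)
  | succ m ih =>
    intro r mem o μ h
    obtain ⟨h1, h2⟩ := hsucc m r mem o μ _ h
    have h3 := h2 fun r' mem' o' μ' h' => ih h'
    refine (h3.of_step (s := ⟨.loop x p :: K, r, mem, o⟩) (by simp [Config.step, h1])).mono ?_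
    rw [Nat.succ_mul]; omega

/-- Repeat `p` as many times as the register `x` says; `R_0` is supposed to hold `1`. -/
def forLoop (x : ℕ) (p : Program) : Program := .loop x (block [p, .sub x x 0])

/-- Invariant rule for counting loops. -/
lemma Halts.forLoop {x : ℕ} {p : Program}
    (P : ℕ → (ℕ → ℕ) → (ℕ → ℕ) → List ℕ → PMF (List ℕ) → Prop)
    (hx : ∀ m r mem o μ, P m r mem o μ → r x = m)
    (hzero : ∀ r mem o μ, P 0 r mem o μ → Halts t ⟨K, r, mem, o⟩ μ)
    (hsucc : ∀ m r mem o μ t' K', P (m + 1) r mem o μ →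
      (∀ r' mem' o' μ', r' x = m + 1 → r' 0 = 1 → P m (Function.update r' x m) mem' o' μ' →
        Halts t' ⟨K', r', mem', o'⟩ μ') →
      Halts (t' + c) ⟨p :: K', r, mem, o⟩ μ)
    (m : ℕ) (h : P m r mem o μ) :
    Halts (t + m * (c + 5) + 1) ⟨PrivateLearning.forLoop x p :: K, r, mem, o⟩ μ := by
  refine Halts.loop (c := c + 4) P (fun r mem o μ h => ⟨hx _ _ _ _ _ h, hzero _ _ _ _ h⟩) ?_ m h
  intro m r mem o μ t' h
  refine ⟨by rw [hx _ _ _ _ _ h]; omega, fun h' => ?_⟩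
  refine Halts.mono (t := t' + 1 + 1 + 1 + c + 1) ?_ (by omega)
  refine Halts.block_cons (hsucc m r mem o μ _ _ h fun r' mem' o' μ' h1 h2 h3 => ?_)
  refine Halts.block_cons (Halts.sub (Halts.block_nil (h' _ _ _ _ ?_)))
  rw [h1, h2]
  exact h3

end Logic

/-! ### Coins on the machine -/

/-- One iteration of a loop that accumulates a disjunction in `acc`. -/
lemma map_or_bind_orRepeat {O : Type*} (ν : PMF Bool) (m : ℕ) (acc : Bool) (μ : Bool → PMF O) :
    ((orRepeat ν (m + 1)).map (acc || ·)).bind μ =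
      ν.bind fun b => ((orRepeat ν m).map ((acc || b) || ·)).bind μ := by
  simp only [orRepeat, PMF.map_bind, PMF.bind_bind, PMF.map_comp]
  refine congrArg _ (funext fun b => ?_)
  congr 2
  ext x; simp [Bool.or_assoc]

/-- One iteration of a loop that accumulates a conjunction in `acc`. -/
lemma map_and_bind_andRepeat {O : Type*} (ν : PMF Bool) (m : ℕ) (acc : Bool) (μ : Bool → PMF O) :
    ((andRepeat ν (m + 1)).map (acc && ·)).bind μ =
      ν.bind fun b => ((andRepeat ν m).map ((acc && b) && ·)).bind μ := by
  simp only [andRepeat, PMF.map_bind, PMF.bind_bind, PMF.map_comp]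
  refine congrArg _ (funext fun b => ?_)
  congr 2
  ext x; simp [Bool.and_assoc]

lemma map_false_or (ν : PMF Bool) : ν.map (false || ·) = ν := by
  have : (fun b : Bool => (false || b)) = id := by ext b; simp
  rw [this, PMF.map_id]

/-- Set `R_18` to the number of ones among `R_5` coin flips. -/
def flipsProgram : Program :=
  block [.const 18 0, .copy 19 5, forLoop 19 (block [.flip 20, .add 18 18 20])]

/-- Set `R_14` to a nonzero number exactly if one of `R_6` trials for the deficit in `R_13`, with
the precision in `R_5`, is successful. -/
def coinProgram : Program :=
  block [.const 14 0, .copy 15 6, forLoop 15 (block [.flip 16, .copy 17 13,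
    forLoop 17 (block [flipsProgram, .cond 18 .skip (.const 16 0)]), .add 14 14 16])]

section Coins

variable {t : ℕ} {K : List Program} {r mem : ℕ → ℕ} {o : List ℕ}

lemma halts_flipsProgram {q : ℕ} {μ : Bool → PMF (List ℕ)} (h0 : r 0 = 1) (hq : r 5 = q)
    (h : ∀ b r', Agree 18 r r' → (r' 18 ≠ 0 ↔ b = true) → Halts t ⟨K, r', mem, o⟩ (μ b)) :
    Halts (t + (q * 10 + 8)) ⟨flipsProgram :: K, r, mem, o⟩ ((orRepeat fairCoin q).bind μ) := by
  refine Halts.mono (t := t + 1 + q * (5 + 5) + 1 + 1 + 1 + 1 + 1 + 1) ?_ (by omega)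
  refine Halts.block_cons (Halts.const (Halts.block_cons (Halts.copy (Halts.block_cons ?_))))
  refine Halts.forLoop (c := 5) (fun m r' mem' o' μ' => mem' = mem ∧ o' = o ∧ Agree 18 r r' ∧
    r' 19 = m ∧ ∃ acc : Bool, (r' 18 ≠ 0 ↔ acc = true) ∧
      μ' = ((orRepeat fairCoin m).map (acc || ·)).bind μ) ?_ ?_ ?_ q ?_
  · rintro m r' mem' o' μ' ⟨-, -, -, h, -⟩; exact h
  · rintro r' mem' o' μ' ⟨rfl, rfl, hag, -, acc, hacc, rfl⟩
    refine Halts.block_nil ?_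
    simpa [orRepeat, PMF.pure_map] using h acc r' hag hacc
  · rintro m r' mem' o' μ' t' K' ⟨rfl, rfl, hag, hm, acc, hacc, rfl⟩ hK
    rw [map_or_bind_orRepeat]
    refine Halts.block_cons (Halts.flip fun b => Halts.block_cons (Halts.add (Halts.block_nil ?_)))
    refine hK _ _ _ _ ?_ ?_ ⟨rfl, rfl, ?_, ?_, acc || b, ?_, rfl⟩
    · simp [hm]
    · simpa [h0] using hag 0 (by norm_num)
    · simpa [agree_update] using hag
    · simp
    · cases b <;> simp [hacc]
  · refine ⟨rfl, rfl, by simp [agree_update, Agree.refl], by simp [hq], false, by simp, ?_⟩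
    rw [map_false_or]

lemma halts_coinProgram {q T u : ℕ} {μ : Bool → PMF (List ℕ)} (h0 : r 0 = 1) (hq : r 5 = q)
    (hT : r 6 = T) (hu : r 13 = u)
    (h : ∀ b r', Agree 13 r r' → (r' 14 ≠ 0 ↔ b = true) → Halts t ⟨K, r', mem, o⟩ (μ b)) :
    Halts (t + (T * (u * (q * 10 + 18) + 20) + 8)) ⟨coinProgram :: K, r, mem, o⟩
      ((queryCoin q T u).bind μ) := by
  refine Halts.mono (t := t + 1 + T * (u * (q * 10 + 13 + 5) + 9 + 5) + 1 + 1 + 1 + 1 + 1 + 1) ?_ ?_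
  swap
  · have : T * (u * (q * 10 + 13 + 5) + 9 + 5) ≤ T * (u * (q * 10 + 18) + 20) :=
      Nat.mul_le_mul_left _ (by change u * (q * 10 + 18) + 9 + 5 ≤ _; omega)
    omega
  refine Halts.block_cons (Halts.const (Halts.block_cons (Halts.copy (Halts.block_cons ?_))))
  refine Halts.forLoop (c := u * (q * 10 + 13 + 5) + 9) (fun m r' mem' o' μ' =>
    mem' = mem ∧ o' = o ∧ Agree 14 r r' ∧ r' 15 = m ∧ ∃ acc : Bool, (r' 14 ≠ 0 ↔ acc = true) ∧
      μ' = ((orRepeat (trial q u) m).map (acc || ·)).bind μ) ?_ ?_ ?_ T ?_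
  · rintro m r' mem' o' μ' ⟨-, -, -, h, -⟩; exact h
  · rintro r' mem' o' μ' ⟨rfl, rfl, hag, -, acc, hacc, rfl⟩
    refine Halts.block_nil ?_
    simpa [orRepeat, PMF.pure_map] using h acc r' (hag.mono (by norm_num)) hacc
  · rintro m r' mem' o' μ' t' K' ⟨rfl, rfl, hag, hm, acc, hacc, rfl⟩ hK
    rw [map_or_bind_orRepeat, trial, PMF.bind_bind]
    refine Halts.mono
      (t := t' + 1 + 1 + 1 + u * (q * 10 + 13 + 5) + 1 + 1 + 1 + 1 + 1 + 1) ?_ (by omega)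
    refine Halts.block_cons (Halts.flip fun b => Halts.block_cons (Halts.copy
      (Halts.block_cons ?_)))
    -- The conjunction of the disjunctions of flips.
    refine Halts.forLoop (c := q * 10 + 13) (fun j r'' mem'' o'' μ'' => mem'' = mem' ∧ o'' = o' ∧
      Agree 16 r' r'' ∧ r'' 17 = j ∧ ∃ b : Bool, r'' 16 = b.toNat ∧
        μ'' = ((andRepeat (orRepeat fairCoin q) j).map (b && ·)).bind fun b =>
          ((orRepeat (trial q u) m).map ((acc || b) || ·)).bind μ) ?_ ?_ ?_ u ?_
    · rintro m r' mem' o' μ' ⟨-, -, -, h, -⟩; exact h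
    · rintro r'' mem'' o'' μ'' ⟨rfl, rfl, hag', -, b, hb, rfl⟩
      refine Halts.block_cons (Halts.add (Halts.block_nil ?_))
      have e1 := hag' 14 (by norm_num)
      have e2 := hag' 15 (by norm_num)
      have e3 := (hag' 0 (by norm_num)).trans (hag 0 (by norm_num))
      simp only [andRepeat, PMF.pure_map, PMF.pure_bind, Bool.and_true]
      refine hK _ _ _ _ (by simp [e2, hm]) (by simp [e3, h0])
        ⟨rfl, rfl, ?_, by simp, acc || b, ?_, rfl⟩
      · simpa [agree_update] using hag.trans (hag'.mono (by norm_num))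
      · cases b <;> simp [hb, e1, hacc]
    · rintro j r'' mem'' o'' μ'' t'' K'' ⟨rfl, rfl, hag', hj, b, hb, rfl⟩ hK'
      rw [map_and_bind_andRepeat]
      refine Halts.mono (t := t'' + 1 + 1 + 1 + 1 + (q * 10 + 8) + 1) ?_ (by omega)
      have e5 := (hag' 5 (by norm_num)).trans (hag 5 (by norm_num))
      have e0 := (hag' 0 (by norm_num)).trans (hag 0 (by norm_num))
      refine Halts.block_cons (halts_flipsProgram (e0.trans h0) (e5.trans hq) fun z s hs hz => ?_)
      refine Halts.block_cons ?_
      have s17 := hs 17 (by norm_num)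
      have s16 := hs 16 (by norm_num)
      have s0 := hs 0 (by norm_num)
      cases z with
      | true =>
        refine Halts.cond_pos (by simpa using hz) (Halts.skip (Halts.block_nil ?_))
        refine hK' _ _ _ _ (by rw [s17, hj]) (by rw [s0, e0, h0])
          ⟨rfl, rfl, ?_, by simp, b, by simp [s16, hb], by simp⟩
        simpa [agree_update] using hag'.trans (hs.mono (by norm_num))
      | false =>
        refine Halts.cond_neg (by simpa using hz) (Halts.const (Halts.block_nil ?_))
        refine hK' _ _ _ _ (by simp [s17, hj]) (by simp [s0, e0, h0])
          ⟨rfl, rfl, ?_, by simp, false, by simp, by simp⟩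
        simpa [agree_update] using hag'.trans (hs.mono (by norm_num))
    · refine ⟨rfl, rfl, by simp [agree_update, Agree.refl], ?_, b, by simp, rfl⟩
      simp [hag 13 (by norm_num), hu]
  · refine ⟨rfl, rfl, by simp [agree_update, Agree.refl], by simp [hT], false, by simp, ?_⟩
    rw [map_false_or, queryCoin]

end Coins

/-! ### Databases in the memory of the machine -/

/-- The memory holds the database `S`: after the seven numbers of the header, each example takes
`d + 1` cells, the last of which is the label. A removed example is marked by the label `2`. -/
def Represents {n d : ℕ} (mem : ℕ → ℕ) (S : Fin n → Option (Sample d)) : Prop :=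
  ∀ s : Fin n, (S s = none → mem (7 + s * (d + 1) + d) = 2) ∧
    ∀ z, S s = some z → (∀ j : Fin d, mem (7 + s * (d + 1) + j) = (z.1 j).toNat) ∧
      mem (7 + s * (d + 1) + d) = z.2.toNat

/-- The contents of the registers that stay fixed once they have been set: the constant `1`, the
polarity, the dimensions of the problem and the parameters of the coins. -/
structure Env (f : Bool) (d n q T : ℕ) (r : ℕ → ℕ) : Prop where
  one : r 0 = 1
  pol : r 1 = f.toNat
  dim : r 2 = d
  size : r 3 = n
  stride : r 4 = d + 1
  bits : r 5 = q
  trials : r 6 = T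

lemma Env.congr {f : Bool} {d n q T b : ℕ} {r r' : ℕ → ℕ} (h : Env f d n q T r) (hr : Agree b r r')
    (hb : 7 ≤ b) : Env f d n q T r' where
  one := (hr 0 (by omega)).trans h.one
  pol := (hr 1 (by omega)).trans h.pol
  dim := (hr 2 (by omega)).trans h.dim
  size := (hr 3 (by omega)).trans h.size
  stride := (hr 4 (by omega)).trans h.stride
  bits := (hr 5 (by omega)).trans h.bits
  trials := (hr 6 (by omega)).trans h.trials

/-- Set `R_22` to `|R_x - R_y|`. -/
def distProgram (x y : ℕ) : Program := block [.sub 22 x y, .sub 23 y x, .add 22 22 23]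

/-- Set `R_13` to the deficit of the literal over the variable `R_10` that fires on the value
`R_11`, for the threshold in `R_8`. -/
def deficitProgram : Program :=
  block [.copy 15 3, .const 23 7, .add 16 23 10, .add 17 23 2, .copy 18 8, .const 19 0,
    forLoop 15 (block [.load 20 16, .load 21 17, distProgram 20 11,
      .cond 22 .skip (block [distProgram 21 1,
        .cond 22 (block [.half 23 21, .cond 23 .skip (.add 19 19 0)]) (.sub 18 18 0)]),
      .add 16 16 4, .add 17 17 4]),
    .add 13 18 19]

/-- Remove all examples whose variable `R_10` has the value `R_11`. -/
def killProgram : Program :=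
  block [.copy 15 3, .const 23 7, .add 16 23 10, .add 17 23 2, .const 21 2,
    forLoop 15 (block [.load 20 16, distProgram 20 11, .cond 22 .skip (.store 17 21),
      .add 16 16 4, .add 17 17 4])]

/-- Decide a query for the literal over the variable `R_10` that fires on the value `R_11` and has
the code `R_12`. -/
def queryProgram : Program :=
  block [deficitProgram, coinProgram, .cond 14 (block [.emit 12, killProgram]) .skip]

section Queries

variable {t : ℕ} {K : List Program} {r mem : ℕ → ℕ} {o : List ℕ} {n d q T τ : ℕ} {f : Bool}
  {S : Fin n → Option (Sample d)}

lemma halts_distProgram {x y : ℕ} {μ : PMF (List ℕ)} (hx : x < 22) (hy : y < 22)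
    (h : ∀ r', Agree 22 r r' → (r' 22 = 0 ↔ r x = r y) → Halts t ⟨K, r', mem, o⟩ μ) :
    Halts (t + 7) ⟨distProgram x y :: K, r, mem, o⟩ μ := by
  refine Halts.block_cons (Halts.sub (Halts.block_cons (Halts.sub (Halts.block_cons
    (Halts.add (Halts.block_nil (h _ ?_ ?_)))))))
  · simp [agree_update, Agree.refl]
  · simp only [Function.update_self, Function.update_of_ne (show x ≠ 22 by omega),
      Function.update_of_ne (show y ≠ 22 by omega),
      Function.update_of_ne (show (22 : ℕ) ≠ 23 by omega)]
    omega

lemma fires_mk (f : Bool) (i : Fin d) (b : Bool) (x : Fin d → Bool) :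
    fires f (i, b) x = true ↔ x i = (b == f) := by
  simp only [fires, Literal.eval]
  cases x i <;> cases b <;> cases f <;> simp

lemma toNat_eq_toNat_iff {a b : Bool} : a.toNat = b.toNat ↔ a = b := by
  cases a <;> cases b <;> simp

lemma halts_deficitProgram {μ : PMF (List ℕ)} (hE : Env f d n q T r) (hτ : r 8 = τ)
    {i : Fin d} {b : Bool} (hi : r 10 = i) (hv : r 11 = (b == f).toNat) (hS : Represents mem S)
    (h : ∀ r', Agree 13 r r' → r' 13 = deficit f S τ (i, b) → Halts t ⟨K, r', mem, o⟩ μ) :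
    Halts (t + (n * 41 + 17)) ⟨deficitProgram :: K, r, mem, o⟩ μ := by
  set G : ℕ → ℕ := fun j => if hj : j < n then goodWeight f (i, b) (S ⟨j, hj⟩) else 0 with hG
  set B : ℕ → ℕ := fun j => if hj : j < n then badWeight f (i, b) (S ⟨j, hj⟩) else 0 with hB
  have hGn : ∑ j ∈ Finset.range n, G j = ∑ s, goodWeight f (i, b) (S s) := by
    rw [Finset.sum_range]; simp [hG]
  have hBn : ∑ j ∈ Finset.range n, B j = ∑ s, badWeight f (i, b) (S s) := by
    rw [Finset.sum_range]; simp [hB]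
  refine Halts.mono (t := t + 1 + 1 + 1 + n * (36 + 5) + 1 + 1 + 12) ?_ (by omega)
  refine Halts.block_cons (Halts.copy (Halts.block_cons (Halts.const (Halts.block_cons (Halts.add
    (Halts.block_cons (Halts.add (Halts.block_cons (Halts.copy (Halts.block_cons (Halts.const
    (Halts.block_cons ?_))))))))))))
  refine Halts.forLoop (c := 36) (fun m r' mem' o' μ' => mem' = mem ∧ o' = o ∧ μ' = μ ∧
    Agree 13 r r' ∧ r' 15 = m ∧ ∃ s, s + m = n ∧ r' 16 = 7 + s * (d + 1) + i ∧
      r' 17 = 7 + s * (d + 1) + d ∧ r' 18 = τ - ∑ j ∈ Finset.range s, G j ∧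
      r' 19 = ∑ j ∈ Finset.range s, B j) ?_ ?_ ?_ n ?_
  · rintro m r' mem' o' μ' ⟨-, -, -, -, h, -⟩; exact h
  · rintro r' mem' o' μ' ⟨rfl, rfl, rfl, hag, -, s, hs, -, -, h18, h19⟩
    obtain rfl : s = n := by omega
    refine Halts.block_cons (Halts.add (Halts.block_nil (h _ ?_ ?_)))
    · simpa [agree_update] using hag
    · simp [h18, h19, hGn, hBn, deficit]
  · rintro m r' mem' o' μ' t' K' ⟨rfl, rfl, rfl, hag, h15, s, hs, h16, h17, h18, h19⟩ hK
    have hsn : s < n := by omega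
    obtain ⟨hnone, hsome⟩ := hS ⟨s, hsn⟩
    have hGs : G s = goodWeight f (i, b) (S ⟨s, hsn⟩) := by simp [hG, hsn]
    have hBs : B s = badWeight f (i, b) (S ⟨s, hsn⟩) := by simp [hB, hsn]
    have r0 := (hag 0 (by norm_num)).trans hE.one
    have r1 := (hag 1 (by norm_num)).trans hE.pol
    have r4 := (hag 4 (by norm_num)).trans hE.stride
    have r11 := (hag 11 (by norm_num)).trans hv
    have tail : ∀ u : ℕ → ℕ, Agree 18 r' u → u 18 = τ - ∑ j ∈ Finset.range (s + 1), G j →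
        u 19 = ∑ j ∈ Finset.range (s + 1), B j →
        Halts (t' + 5) ⟨block [.add 16 16 4, .add 17 17 4] :: K', u, mem', o'⟩ μ' := by
      intro u hu h18 h19
      have u0 := (hu 0 (by norm_num)).trans r0
      have u4 := (hu 4 (by norm_num)).trans r4
      have u15 := (hu 15 (by norm_num)).trans h15
      have u16 := (hu 16 (by norm_num)).trans h16
      have u17 := (hu 17 (by norm_num)).trans h17
      refine Halts.block_cons (Halts.add (Halts.block_cons (Halts.add (Halts.block_nil ?_))))
      refine hK _ _ _ _ (by simp [u15]) (by simp [u0]) ⟨rfl, rfl, rfl, ?_, by simp, s + 1,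
        by omega, ?_, ?_, by simp [h18], by simp [h19]⟩
      · simpa [agree_update] using hag.trans (hu.mono (by norm_num))
      · simp [u16, u4]; ring
      · simp [u17, u4]; ring
    rw [Finset.sum_range_succ, hGs, Finset.sum_range_succ, hBs, ← Nat.sub_sub, ← h18, ← h19] at tail
    refine Halts.mono (t := t' + 5 + 17 + 1 + 1 + 7 + 5) ?_ (by omega)
    refine Halts.block_cons (Halts.load (Halts.block_cons (Halts.load (Halts.block_cons
      (halts_distProgram (by norm_num) (by norm_num) fun u hu hu22 => Halts.block_cons ?_)))))
    have hu' : Agree 18 r' u := fun y hy => by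
      rw [hu y (by omega)]; simp [show y ≠ 20 by omega, show y ≠ 21 by omega]
    have u18 : u 18 = r' 18 := hu 18 (by norm_num)
    have u19 : u 19 = r' 19 := hu 19 (by norm_num)
    have u21 : u 21 = mem' (7 + s * (d + 1) + d) := by simpa [h17] using hu 21 (by norm_num)
    have u1 := (hu' 1 (by norm_num)).trans r1
    have u0 := (hu' 0 (by norm_num)).trans r0
    norm_num [h16, r11, Function.update_apply] at hu22
    by_cases hx : u 22 = 0
    · refine Halts.mono (t := t' + 5 + 1 + 6 + 1 + 1 + 7 + 1 + 1) ?_ (by omega)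
      refine Halts.cond_neg hx (Halts.block_cons
        (halts_distProgram (by norm_num) (by norm_num) fun w hw hw22 => Halts.block_cons ?_))
      rw [u21, u1] at hw22
      have hw' : Agree 18 r' w := hu'.trans (hw.mono (by norm_num))
      have w18 : w 18 = r' 18 := (hw 18 (by norm_num)).trans u18
      have w19 : w 19 = r' 19 := (hw 19 (by norm_num)).trans u19
      have w21 := (hw 21 (by norm_num)).trans u21
      have w0 := (hw 0 (by norm_num)).trans u0
      rcases hSs : S ⟨s, hsn⟩ with _ | z
      -- The label `2` of a removed example is neither `f` nor `!f`, and its half is nonzero.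
      · have h2 := hnone hSs
        simp only at h2
        rw [h2] at w21 hw22
        refine Halts.cond_pos (fun h0 => ?_) (Halts.block_cons (Halts.half (Halts.block_cons
          (Halts.cond_pos (by simp [w21]) (Halts.skip (Halts.block_nil (Halts.block_nil
          (tail _ ?_ ?_ ?_))))))))
        · have := hw22.1 h0
          cases f <;> simp at this
        · simpa [agree_update] using hw'
        · simp [w18, hSs, goodWeight]
        · simp [w19, hSs, badWeight]
      · obtain ⟨hz1, hz2⟩ := hsome z hSs
        simp only at hz1 hz2
        have hfire : fires f (i, b) z.1 = true := by
          rw [fires_mk, ← toNat_eq_toNat_iff, ← hz1 i]; exact hu22.1 hx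
        rw [hz2, toNat_eq_toNat_iff] at hw22
        rw [hz2] at w21
        by_cases hy : z.2 = f
        · refine Halts.mono (t := t' + 5 + 1 + 1 + 1) ?_ (by omega)
          refine Halts.cond_neg (hw22.2 hy) (Halts.sub (Halts.block_nil (tail _ ?_ ?_ ?_)))
          · simpa [agree_update] using hw'
          · simp [w18, w0, hSs, goodWeight, hfire, hy]
          · simp [w19, hSs, badWeight, hy]
        · refine Halts.cond_pos (fun h0 => hy (hw22.1 h0)) (Halts.block_cons (Halts.half
            (Halts.block_cons (Halts.cond_neg ?_ (Halts.add (Halts.block_nil (Halts.block_nil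
            (tail _ ?_ ?_ ?_))))))))
          · cases hz : z.2 <;> simp [w21, hz]
          · simpa [agree_update] using hw'
          · simp [w18, hSs, goodWeight, hy]
          · simp [w19, w0, hSs, badWeight, hfire, hy]
    · refine Halts.mono (t := t' + 5 + 1 + 1) ?_ (by omega)
      refine Halts.cond_pos hx (Halts.skip (tail u hu' ?_ ?_))
      all_goals rcases hSs : S ⟨s, hsn⟩ with _ | z
      · simp [u18, goodWeight]
      · have hfire : ¬ fires f (i, b) z.1 = true := by
          rw [fires_mk, ← toNat_eq_toNat_iff, ← (hsome z hSs).1 i]; exact fun h => hx (hu22.2 h)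
        simp [u18, goodWeight, hfire]
      · simp [u19, badWeight]
      · have hfire : ¬ fires f (i, b) z.1 = true := by
          rw [fires_mk, ← toNat_eq_toNat_iff, ← (hsome z hSs).1 i]; exact fun h => hx (hu22.2 h)
        simp [u19, badWeight, hfire]
  · refine ⟨rfl, rfl, rfl, by simp [agree_update, Agree.refl], by simp [hE.size], 0, by simp, ?_, ?_,
      ?_, ?_⟩
    · simp [hi]
    · simp [hE.dim]
    · simp [hτ]
    · simp

/-- The label cells of different examples are different, and they hold no variables. -/
lemma label_address_inj {s s' j : ℕ} (hj : j ≤ d)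
    (h : 7 + s' * (d + 1) + j = 7 + s * (d + 1) + d) : s' = s ∧ j = d := by
  rcases lt_trichotomy s' s with hlt | rfl | hlt
  · have := Nat.mul_le_mul_right (d + 1) hlt
    rw [Nat.succ_mul] at this; omega
  · omega
  · have := Nat.mul_le_mul_right (d + 1) hlt
    rw [Nat.succ_mul] at this; omega

lemma Represents.remove (hS : Represents mem S) (s : Fin n) :
    Represents (Function.update mem (7 + s * (d + 1) + d) 2) (Function.update S s none) := by
  intro s'
  by_cases hs : s' = s
  · subst hs
    exact ⟨fun _ => by simp, fun z hz => by simp at hz⟩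
  · have hne : (s' : ℕ) ≠ s := fun h => hs (Fin.ext h)
    have haddr : ∀ j, j ≤ d → 7 + (s' : ℕ) * (d + 1) + j ≠ 7 + (s : ℕ) * (d + 1) + d :=
      fun j hj h => hne (label_address_inj hj h).1
    rw [Function.update_of_ne hs, Function.update_of_ne (haddr d le_rfl)]
    refine ⟨(hS s').1, fun z hz => ⟨fun j => ?_, ((hS s').2 z hz).2⟩⟩
    rw [Function.update_of_ne (haddr j j.2.le)]
    exact ((hS s').2 z hz).1 j

lemma halts_killProgram {μ : PMF (List ℕ)} (hE : Env f d n q T r)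
    {i : Fin d} {b : Bool} (hi : r 10 = i) (hv : r 11 = (b == f).toNat) (hS : Represents mem S)
    (h : ∀ r' mem', Agree 13 r r' → Represents mem' (kill f (i, b) S) →
      Halts t ⟨K, r', mem', o⟩ μ) :
    Halts (t + (n * 23 + 13)) ⟨killProgram :: K, r, mem, o⟩ μ := by
  -- The database after the first `s` entries have been processed.
  set S' : ℕ → Fin n → Option (Sample d) := fun s j =>
    if (j : ℕ) < s then kill f (i, b) S j else S j with hS'
  refine Halts.mono (t := t + 1 + n * (18 + 5) + 1 + 1 + 10) ?_ (by omega)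
  refine Halts.block_cons (Halts.copy (Halts.block_cons (Halts.const (Halts.block_cons (Halts.add
    (Halts.block_cons (Halts.add (Halts.block_cons (Halts.const (Halts.block_cons ?_))))))))))
  refine Halts.forLoop (c := 18) (fun m r' mem' o' μ' => o' = o ∧ μ' = μ ∧
    Agree 13 r r' ∧ r' 15 = m ∧ ∃ s, s + m = n ∧ r' 16 = 7 + s * (d + 1) + i ∧
      r' 17 = 7 + s * (d + 1) + d ∧ r' 21 = 2 ∧ Represents mem' (S' s)) ?_ ?_ ?_ n ?_
  · rintro m r' mem' o' μ' ⟨-, -, -, h, -⟩; exact h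
  · rintro r' mem' o' μ' ⟨rfl, rfl, hag, -, s, hs, -, -, -, hrep⟩
    obtain rfl : s = n := by omega
    have : S' s = kill f (i, b) S := funext fun j => by simp [hS', j.2]
    exact Halts.block_nil (h _ _ hag (this ▸ hrep))
  · rintro m r' mem' o' μ' t' K' ⟨rfl, rfl, hag, h15, s, hs, h16, h17, h21, hrep⟩ hK
    have hsn : s < n := by omega
    have r0 := (hag 0 (by norm_num)).trans hE.one
    have r4 := (hag 4 (by norm_num)).trans hE.stride
    have r11 := (hag 11 (by norm_num)).trans hv
    have hself : S' s ⟨s, hsn⟩ = S ⟨s, hsn⟩ := by simp [hS']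
    have hsucc : ∀ v, kill f (i, b) S ⟨s, hsn⟩ = v →
        S' (s + 1) = Function.update (S' s) ⟨s, hsn⟩ v := fun v hv => by
      ext1 j
      by_cases hj : j = ⟨s, hsn⟩
      · subst hj; simp [hS', hv]
      · have hne : (j : ℕ) ≠ s := fun h => hj (Fin.ext h)
        rw [Function.update_of_ne hj]
        simp only [hS', show (j : ℕ) < s + 1 ↔ (j : ℕ) < s by omega]
    have tail : ∀ (u mem'' : ℕ → ℕ), Agree 20 r' u → u 21 = 2 → Represents mem'' (S' (s + 1)) →
        Halts (t' + 5) ⟨block [.add 16 16 4, .add 17 17 4] :: K', u, mem'', o'⟩ μ' := by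
      intro u mem'' hu u21 hrep'
      have u0 := (hu 0 (by norm_num)).trans r0
      have u4 := (hu 4 (by norm_num)).trans r4
      have u15 := (hu 15 (by norm_num)).trans h15
      have u16 := (hu 16 (by norm_num)).trans h16
      have u17 := (hu 17 (by norm_num)).trans h17
      refine Halts.block_cons (Halts.add (Halts.block_cons (Halts.add (Halts.block_nil ?_))))
      refine hK _ _ _ _ (by simp [u15]) (by simp [u0]) ⟨rfl, rfl, ?_, by simp, s + 1,
        by omega, ?_, ?_, by simp [u21], hrep'⟩
      · simpa [agree_update] using hag.trans (hu.mono (by norm_num))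
      · simp [u16, u4]; ring
      · simp [u17, u4]; ring
    refine Halts.mono (t := t' + 5 + 1 + 1 + 1 + 7 + 1 + 1 + 1) ?_ (by omega)
    refine Halts.block_cons (Halts.load (Halts.block_cons
      (halts_distProgram (by norm_num) (by norm_num) fun u hu hu22 => Halts.block_cons ?_)))
    have hu' : Agree 20 r' u := fun y hy => by
      rw [hu y (by omega), Function.update_of_ne (by omega)]
    have u21 : u 21 = 2 := (hu 21 (by norm_num)).trans (by simp [h21])
    have u17 := (hu' 17 (by norm_num)).trans h17
    norm_num [h16, r11, Function.update_apply] at hu22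
    refine Halts.mono (t := t' + 5 + 1 + 1) ?_ (by omega)
    by_cases hx : u 22 = 0
    · refine Halts.cond_neg hx (Halts.store (tail _ _ hu' u21 ?_))
      rw [u17, u21, hsucc none ?_]
      · exact hrep.remove ⟨s, hsn⟩
      · rcases hSs : S ⟨s, hsn⟩ with _ | z
        · simp [kill, hSs]
        · have hfire : fires f (i, b) z.1 = true := by
            rw [fires_mk, ← toNat_eq_toNat_iff, ← ((hrep ⟨s, hsn⟩).2 z (hself.trans hSs)).1 i]
            exact hu22.1 hx
          simp [kill, hSs, Option.filter, hfire]
    · refine Halts.cond_pos hx (Halts.skip (tail _ _ hu' u21 ?_))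
      rw [hsucc (S ⟨s, hsn⟩) ?_]
      · rw [← hself, Function.update_eq_self]; exact hrep
      · rcases hSs : S ⟨s, hsn⟩ with _ | z
        · simp [kill, hSs]
        · have hfire : ¬ fires f (i, b) z.1 = true := by
            rw [fires_mk, ← toNat_eq_toNat_iff, ← ((hrep ⟨s, hsn⟩).2 z (hself.trans hSs)).1 i]
            exact fun h => hx (hu22.2 h)
          simp [kill, hSs, Option.filter, hfire]
  · refine ⟨rfl, rfl, by simp [agree_update, Agree.refl], by simp [hE.size], 0, by simp, ?_, ?_,
      by simp, ?_⟩
    · simp [hi]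
    · simp [hE.dim]
    · simpa [hS'] using hS

lemma deficit_le (f : Bool) (S : Fin n → Option (Sample d)) (τ : ℕ) (l : Literal d) :
    deficit f S τ l ≤ τ + n := by
  refine add_le_add (Nat.sub_le _ _) ?_
  calc ∑ i, badWeight f l (S i) ≤ ∑ _i : Fin n, 1 := Finset.sum_le_sum fun i _ => by
        rcases S i with _ | z <;> simp only [badWeight]
        · omega
        · split_ifs <;> omega
    _ = n := by simp

/-- The law of the output of the machine that has already written `o` and whose remaining queries
are `Q`. -/
noncomputable def outputLaw (f : Bool) (q T : ℕ) (o : List ℕ) (Q : List (ℕ × Literal d))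
    (S : Fin n → Option (Sample d)) : PMF (List ℕ) :=
  (learn f q T Q S).map fun ψ => o ++ encodeFormula ψ

lemma outputLaw_cons (f : Bool) (q T : ℕ) (o : List ℕ) (τ : ℕ) (l : Literal d)
    (Q : List (ℕ × Literal d)) (S : Fin n → Option (Sample d)) :
    outputLaw f q T o ((τ, l) :: Q) S = (queryCoin q T (deficit f S τ l)).bind fun b =>
      if b then outputLaw f q T (o ++ [2 * (l.1 : ℕ) + l.2.toNat]) Q (kill f l S)
      else outputLaw f q T o Q S := by
  simp only [outputLaw, learn, PMF.map_bind]
  refine congrArg _ (funext fun b => ?_)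
  cases b
  · simp
  · simp only [if_true, PMF.map_comp]
    congr 1
    funext ψ
    simp [encodeFormula]

/-- A bound for the number of steps of a query. -/
def queryTime (n q T : ℕ) : ℕ := n * 64 + T * (2 * n * (q * 10 + 18) + 20) + 50

/-- The program of a query implements one step of the recursion that defines `learn`. -/
lemma halts_queryProgram {Q : List (ℕ × Literal d)} (hE : Env f d n q T r) (hτ : r 8 = τ)
    (hτn : τ ≤ n) {i : Fin d} {b : Bool} (hi : r 10 = i) (hv : r 11 = (b == f).toNat)
    (hc : r 12 = 2 * i + b.toNat) (hS : Represents mem S)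
    (h : ∀ r' mem' o' (S' : Fin n → Option (Sample d)), Agree 13 r r' → Represents mem' S' →
      Halts t ⟨K, r', mem', o'⟩ (outputLaw f q T o' Q S')) :
    Halts (t + queryTime n q T) ⟨queryProgram :: K, r, mem, o⟩
      (outputLaw f q T o ((τ, (i, b)) :: Q) S) := by
  set u := deficit f S τ (i, b) with hu
  refine Halts.mono (t := t + 1 + 1 + (n * 23 + 13) + 1 + 1 + 1 + 1 + 1 +
    (T * (u * (q * 10 + 18) + 20) + 8) + 1 + (n * 41 + 17) + 1) ?_ ?_
  swap
  · have h1 : u ≤ 2 * n := (deficit_le f S τ (i, b)).trans (by omega)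
    have h2 : u * (q * 10 + 18) ≤ 2 * n * (q * 10 + 18) := Nat.mul_le_mul_right _ h1
    have h3 : T * (u * (q * 10 + 18) + 20) ≤ T * (2 * n * (q * 10 + 18) + 20) :=
      Nat.mul_le_mul_left _ (by omega)
    unfold queryTime
    omega
  rw [outputLaw_cons]
  refine Halts.block_cons (halts_deficitProgram hE hτ hi hv hS fun r₁ h₁ hu₁ => ?_)
  have hE₁ := hE.congr h₁ (by norm_num)
  refine Halts.block_cons (halts_coinProgram hE₁.one hE₁.bits hE₁.trials hu₁ fun z r₂ h₂ hz => ?_)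
  have h₁₂ := h₁.trans h₂
  refine Halts.block_cons ?_
  cases z with
  | true =>
    refine Halts.cond_pos (hz.2 rfl) (Halts.block_cons (Halts.emit (Halts.block_cons ?_)))
    refine halts_killProgram (hE.congr h₁₂ (by norm_num)) ((h₁₂ 10 (by norm_num)).trans hi)
      ((h₁₂ 11 (by norm_num)).trans hv) hS fun r₃ mem' h₃ hm => Halts.block_nil (Halts.block_nil ?_)
    rw [(h₁₂ 12 (by norm_num)).trans hc]
    exact h _ _ _ _ (h₁₂.trans h₃) hm
  | false =>
    refine Halts.mono (t := t + 1 + 1 + 1) ?_ (by omega)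
    exact Halts.cond_neg (by simpa using hz) (Halts.skip (Halts.block_nil (h _ _ _ _ h₁₂ hS)))

end Queries

/-! ### The program of the learner -/

/-- Add the number of binary digits of `R_y` to `R_x`. -/
def sizeProgram (x y : ℕ) : Program :=
  block [.copy 15 y, .loop 15 (block [.half 15 15, .add x x 0])]

/-- Add the number of binary digits of `M[a]` to `R_x`. -/
def loadSizeProgram (x a : ℕ) : Program := block [.const 16 a, .load 16 16, sizeProgram x 16]

/-- Set up the registers: the polarity is `f`, the parameters are computed from the input. The cells
`0, …, 6` of the memory hold `k`, `d`, `n` and the rounded inverses of `α`, `β`, `ε`, `δ`. -/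
def initProgram (f : Bool) : Program :=
  block [.const 0 1, .const 1 f.toNat, .const 16 1, .load 2 16, .const 16 2, .load 3 16, .add 4 2 0,
    .copy 8 3, .const 7 3, loadSizeProgram 7 0, loadSizeProgram 7 3, .const 6 3,
    loadSizeProgram 6 1, loadSizeProgram 6 4, .add 6 6 7, .const 5 5, loadSizeProgram 5 5,
    .const 17 0, loadSizeProgram 17 6, sizeProgram 5 17]

/-- The queries for the two literals over the variable `R_10`: the negated variable fires on the
value `!f`, the variable itself on the value `f`. -/
def variableProgram : Program :=
  block [.add 12 10 10, .sub 11 0 1, queryProgram, .add 12 12 0, .copy 11 1, queryProgram,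
    .add 10 10 0]

/-- Halve the threshold in `R_8` and query all literals. -/
def passProgram : Program :=
  block [.half 8 8, .const 10 0, .copy 9 2, forLoop 9 variableProgram]

/-- The program of the learner. -/
def learnerProgram (f : Bool) : Program := block [initProgram f, forLoop 7 passProgram]

section Program

variable {t : ℕ} {K : List Program} {r mem : ℕ → ℕ} {o : List ℕ} {n d q T τ : ℕ} {f : Bool}
  {S : Fin n → Option (Sample d)}

/-- A bound for the number of steps of a pass. -/
def passTime (n d q T : ℕ) : ℕ := d * (2 * queryTime n q T + 18) + 9

/-- The program of a pass implements the queries for all literals with half the threshold. -/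
lemma halts_passProgram {Q : List (ℕ × Literal d)} (hE : Env f d n q T r) (hτ : r 8 = τ)
    (hτn : τ ≤ n) (hS : Represents mem S)
    (h : ∀ r' mem' o' (S' : Fin n → Option (Sample d)), Env f d n q T r' → r' 7 = r 7 →
      r' 8 = τ / 2 → Represents mem' S' → Halts t ⟨K, r', mem', o'⟩ (outputLaw f q T o' Q S')) :
    Halts (t + passTime n d q T) ⟨passProgram :: K, r, mem, o⟩
      (outputLaw f q T o ((allLiterals d).map (fun l => (τ / 2, l)) ++ Q) S) := by
  unfold passTime
  set D := queryTime n q T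
  refine Halts.mono (t := t + 1 + d * (2 * D + 13 + 5) + 1 + 1 + 6) ?_
    (by change _ ≤ t + (d * (2 * D + 13 + 5) + 9); omega)
  refine Halts.block_cons (Halts.half (Halts.block_cons (Halts.const (Halts.block_cons (Halts.copy
    (Halts.block_cons ?_))))))
  refine Halts.forLoop (c := 2 * D + 13) (fun m r' mem' o' μ' => Env f d n q T r' ∧ r' 7 = r 7 ∧
    r' 8 = τ / 2 ∧ r' 9 = m ∧ ∃ (i : ℕ) (S' : Fin n → Option (Sample d)), i + m = d ∧ r' 10 = i ∧
      Represents mem' S' ∧ μ' = outputLaw f q T o' ((((List.finRange d).drop i).flatMap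
        fun i => [(i, false), (i, true)]).map (fun l => (τ / 2, l)) ++ Q) S') ?_ ?_ ?_ d ?_
  · rintro m r' mem' o' μ' ⟨-, -, -, h, -⟩; exact h
  · rintro r' mem' o' μ' ⟨hE', h7, h8, -, i, S', hi, -, hS', rfl⟩
    obtain rfl : i = d := by omega
    have : (List.finRange i).drop i = [] := List.drop_eq_nil_of_le (by simp)
    rw [this]
    exact Halts.block_nil (h _ _ _ _ hE' h7 h8 hS')
  · rintro m r' mem' o' μ' t' K' ⟨hE', h7, h8, h9, i, S', hi, h10, hS', rfl⟩ hK
    have hid : i < d := by omega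
    have hdrop : (List.finRange d).drop i = ⟨i, hid⟩ :: (List.finRange d).drop (i + 1) := by
      rw [List.drop_eq_getElem_cons (by simpa using hid)]; simp
    rw [hdrop]
    simp only [List.flatMap_cons, List.cons_append, List.nil_append, List.map_cons]
    refine Halts.mono (t := t' + 1 + 1 + 1 + D + 1 + 1 + 1 + 1 + 1 + D + 1 + 1 + 1 + 1 + 1) ?_
      (by omega)
    have hτ' : τ / 2 ≤ n := (Nat.div_le_self _ _).trans hτn
    refine Halts.block_cons (Halts.add (Halts.block_cons (Halts.sub (Halts.block_cons ?_))))
    refine halts_queryProgram (i := ⟨i, hid⟩) (b := false) (hE'.congr (b := 11) ?_ (by norm_num)) ?_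
      hτ' ?_ ?_ ?_ hS' fun r₁ mem₁ o₁ S₁ h₁ hS₁ => ?_
    · simp [agree_update, Agree.refl]
    · simp [h8]
    · simp [h10]
    · simp only [Function.update_self, Function.update_of_ne (show (0 : ℕ) ≠ 12 by norm_num),
        Function.update_of_ne (show (1 : ℕ) ≠ 12 by norm_num), hE'.one, hE'.pol]
      cases f <;> rfl
    · simp [h10]; ring
    have h₁' : Agree 11 r' r₁ := fun y hy => by
      rw [h₁ y (by omega), Function.update_of_ne (by omega), Function.update_of_ne (by omega)]
    have hE₁ := hE'.congr h₁' (by norm_num)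
    have r12 : r₁ 12 = 2 * i := by rw [h₁ 12 (by norm_num)]; simp [h10]; ring
    have r10 := (h₁' 10 (by norm_num)).trans h10
    refine Halts.block_cons (Halts.add (Halts.block_cons (Halts.copy (Halts.block_cons ?_))))
    refine halts_queryProgram (i := ⟨i, hid⟩) (b := true) (hE₁.congr (b := 11) ?_ (by norm_num)) ?_
      hτ' ?_ ?_ ?_ hS₁ fun r₂ mem₂ o₂ S₂ h₂ hS₂ => ?_
    · simp [agree_update, Agree.refl]
    · simp [h₁' 8 (by norm_num), h8]
    · simp [r10]
    · simp only [Function.update_self, Function.update_of_ne (show (1 : ℕ) ≠ 12 by norm_num),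
        hE₁.pol]
      cases f <;> rfl
    · simp [r12, hE₁.one]
    have h₂' : Agree 11 r' r₂ := h₁'.trans fun y hy => by
      rw [h₂ y (by omega), Function.update_of_ne (by omega), Function.update_of_ne (by omega)]
    refine Halts.block_cons (Halts.add (Halts.block_nil ?_))
    have hE₂ := hE'.congr h₂' (by norm_num)
    refine hK _ _ _ _ ?_ ?_ ⟨hE₂.congr (b := 9) ?_ (by norm_num), ?_, ?_, by simp, i + 1, S₂,
      by omega, ?_, hS₂, rfl⟩
    · simp [h₂' 9 (by norm_num), h9]
    · simp [hE₂.one]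
    · simp [agree_update, Agree.refl]
    · simp [h₂' 7 (by norm_num), h7]
    · simp [h₂' 8 (by norm_num), h8]
    · simp [h₂' 10 (by norm_num), h10, hE₂.one]
  · refine ⟨hE.congr (b := 7) ?_ (by norm_num), by simp, by simp [hτ], by simp [hE.dim], 0, S,
      by simp, by simp, hS, by simp [allLiterals]⟩
    simp [agree_update, Agree.refl]

lemma size_div_two {v : ℕ} (hv : v ≠ 0) : v.size = (v / 2).size + 1 := by
  have hpos : 0 < v.size := Nat.size_pos.2 (Nat.pos_of_ne_zero hv)
  apply le_antisymm
  · rw [Nat.size_le, pow_succ]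
    have := Nat.lt_size_self (v / 2)
    omega
  · have : (v / 2).size ≤ v.size - 1 := by
      rw [Nat.size_le]
      have h1 := Nat.lt_size_self v
      have h2 : 2 ^ v.size = 2 * 2 ^ (v.size - 1) := by rw [← pow_succ']; congr 1; omega
      omega
    omega

lemma halts_sizeProgram {x y : ℕ} {μ : PMF (List ℕ)} (hx0 : x ≠ 0) (hx : x ≠ 15) (h0 : r 0 = 1)
    (h : ∀ r', (∀ z, z ≠ 15 → z ≠ x → r' z = r z) → r' x = r x + (r y).size →
      Halts t ⟨K, r', mem, o⟩ μ) :
    Halts (t + ((r y).size * 6 + 5)) ⟨sizeProgram x y :: K, r, mem, o⟩ μ := by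
  refine Halts.mono (t := t + 1 + (r y).size * (5 + 1) + 1 + 1 + 2) ?_ (by omega)
  refine Halts.block_cons (Halts.copy (Halts.block_cons ?_))
  refine Halts.loop (c := 5) (fun m r' mem' o' μ' => mem' = mem ∧ o' = o ∧ μ' = μ ∧
    (∀ z, z ≠ 15 → z ≠ x → r' z = r z) ∧ (r' 15).size = m ∧ r' x + m = r x + (r y).size) ?_ ?_
    (r y).size ?_
  · rintro r' mem' o' μ' ⟨rfl, rfl, rfl, hag, hm, hx'⟩
    exact ⟨Nat.size_eq_zero.1 hm, Halts.block_nil (h _ hag hx')⟩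
  · rintro m r' mem' o' μ' t' ⟨rfl, rfl, rfl, hag, hm, hx'⟩
    have hne : r' 15 ≠ 0 := fun h0 => by simp [h0] at hm
    have hs := size_div_two hne
    refine ⟨hne, fun hK => ?_⟩
    refine Halts.block_cons (Halts.half (Halts.block_cons (Halts.add (Halts.block_nil (hK _ _ _ _
      ⟨rfl, rfl, rfl, ?_, ?_, ?_⟩)))))
    · intro z hz hzx
      rw [Function.update_of_ne hzx, Function.update_of_ne hz, hag z hz hzx]
    · rw [Function.update_of_ne hx.symm, Function.update_self]; omega
    · have e0 := hag 0 (by norm_num) hx0.symm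
      rw [Function.update_self, Function.update_of_ne hx, Function.update_of_ne (by norm_num)]
      omega
  · refine ⟨rfl, rfl, rfl, fun z hz _ => by rw [Function.update_of_ne hz], by simp, ?_⟩
    rw [Function.update_of_ne hx]

lemma halts_loadSizeProgram {x a : ℕ} {μ : PMF (List ℕ)} (hx0 : x ≠ 0) (hx : x ≠ 15) (hx' : x ≠ 16)
    (h0 : r 0 = 1)
    (h : ∀ r', (∀ z, z ≠ 15 → z ≠ 16 → z ≠ x → r' z = r z) → r' x = r x + (mem a).size →
      Halts t ⟨K, r', mem, o⟩ μ) :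
    Halts (t + ((mem a).size * 6 + 11)) ⟨loadSizeProgram x a :: K, r, mem, o⟩ μ := by
  have key : Halts (t + 1 + ((mem a).size * 6 + 5) + 1 + 4)
      ⟨loadSizeProgram x a :: K, r, mem, o⟩ μ := by
    refine Halts.block_cons (Halts.const (Halts.block_cons (Halts.load (Halts.block_cons ?_))))
    have hs : mem a = Function.update (Function.update r 16 a) 16
        (mem (Function.update r 16 a 16)) 16 := by simp
    rw [hs]
    refine halts_sizeProgram hx0 hx (by simp [h0]) fun r' hr' hrx => Halts.block_nil (h r' ?_ ?_)
    · intro z h15 h16 hzx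
      rw [hr' z h15 hzx, Function.update_of_ne h16, Function.update_of_ne h16]
    · rw [hrx, Function.update_of_ne hx', Function.update_of_ne hx']; simp
  exact key.mono (by omega)

/-- A bound for the number of steps of the initialization, if the numbers in the header of the input
have at most `M` binary digits. -/
def initTime (M : ℕ) : ℕ := 42 * M + 110

lemma halts_initProgram {M : ℕ} {μ : PMF (List ℕ)} (hM : ∀ a < 7, (mem a).size ≤ M)
    (h : ∀ r', Env f (mem 1) (mem 2) (numBits (mem 5) (mem 6))
        (numTrials (mem 0) (mem 1) (mem 3) (mem 4)) r' →
      r' 7 = numPasses (mem 0) (mem 3) → r' 8 = mem 2 → Halts t ⟨K, r', mem, o⟩ μ) :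
    Halts (t + initTime M) ⟨initProgram f :: K, r, mem, o⟩ μ := by
  have m0 := hM 0 (by norm_num)
  have m1 := hM 1 (by norm_num)
  have m3 := hM 3 (by norm_num)
  have m4 := hM 4 (by norm_num)
  have m5 := hM 5 (by norm_num)
  have m6 := hM 6 (by norm_num)
  have m66 : (mem 6).size.size ≤ M := (Nat.size_le.2 Nat.lt_two_pow_self).trans m6
  refine Halts.mono (t := t + 1 + ((mem 6).size.size * 6 + 5) + 1 + ((mem 6).size * 6 + 11) + 1 + 2 +
    ((mem 5).size * 6 + 11) + 1 + 2 + 2 + ((mem 4).size * 6 + 11) + 1 + ((mem 1).size * 6 + 11) + 1 +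
    2 + ((mem 3).size * 6 + 11) + 1 + ((mem 0).size * 6 + 11) + 1 + 18) ?_ ?_
  swap
  · unfold initTime; omega
  refine Halts.block_cons (Halts.const (Halts.block_cons (Halts.const (Halts.block_cons (Halts.const
    (Halts.block_cons (Halts.load (Halts.block_cons (Halts.const (Halts.block_cons (Halts.load
    (Halts.block_cons (Halts.add (Halts.block_cons (Halts.copy (Halts.block_cons (Halts.const
    (Halts.block_cons ?_))))))))))))))))))
  refine halts_loadSizeProgram (by norm_num) (by norm_num) (by norm_num) (by simp)
    fun r₁ h₁ h₁' => Halts.block_cons ?_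
  refine halts_loadSizeProgram (by norm_num) (by norm_num) (by norm_num) (by simp [h₁])
    fun r₂ h₂ h₂' => Halts.block_cons (Halts.const (Halts.block_cons ?_))
  refine halts_loadSizeProgram (by norm_num) (by norm_num) (by norm_num) (by simp [h₁, h₂])
    fun r₃ h₃ h₃' => Halts.block_cons ?_
  refine halts_loadSizeProgram (by norm_num) (by norm_num) (by norm_num) (by simp [h₁, h₂, h₃])
    fun r₄ h₄ h₄' => Halts.block_cons (Halts.add (Halts.block_cons (Halts.const
      (Halts.block_cons ?_))))
  refine halts_loadSizeProgram (by norm_num) (by norm_num) (by norm_num) (by simp [h₁, h₂, h₃, h₄])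
    fun r₅ h₅ h₅' => Halts.block_cons (Halts.const (Halts.block_cons ?_))
  refine halts_loadSizeProgram (by norm_num) (by norm_num) (by norm_num)
    (by simp [h₁, h₂, h₃, h₄, h₅]) fun r₆ h₆ h₆' => Halts.block_cons ?_
  have h17 : r₆ 17 = (mem 6).size := by simpa using h₆'
  rw [← h17]
  refine halts_sizeProgram (by norm_num) (by norm_num) (by simp [h₁, h₂, h₃, h₄, h₅, h₆])
    fun r₇ h₇ h₇' => Halts.block_nil (h r₇ ⟨?_, ?_, ?_, ?_, ?_, ?_, ?_⟩ ?_ ?_)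
  · simp [h₁, h₂, h₃, h₄, h₅, h₆, h₇]
  · simp [h₁, h₂, h₃, h₄, h₅, h₆, h₇]
  · simp [h₁, h₂, h₃, h₄, h₅, h₆, h₇]
  · simp [h₁, h₂, h₃, h₄, h₅, h₆, h₇]
  · simp [h₁, h₂, h₃, h₄, h₅, h₆, h₇]
  · rw [h₇', h17]; simp [h₅', h₆, numBits]; ring
  · simp [h₁', h₂', h₃, h₃', h₄, h₄', h₅, h₆, h₇, numTrials, numPasses]; ring
  · simp [h₁', h₂', h₃, h₄, h₅, h₆, h₇, numPasses]; ring
  · simp [h₁, h₂, h₃, h₄, h₅, h₆, h₇]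

/-- A bound for the number of steps of the learner. -/
def learnerTime (n d q T J M : ℕ) : ℕ := J * (passTime n d q T + 5) + initTime M + 4

/-- The program of the learner implements `learn` with the parameters `numBits`, `numTrials` and
`numPasses`. -/
theorem halts_learnerProgram {M a b e s k : ℕ} (hM : ∀ a < 7, (mem a).size ≤ M) (h0 : mem 0 = k)
    (h1 : mem 1 = d) (h2 : mem 2 = n) (h3 : mem 3 = a) (h4 : mem 4 = b) (h5 : mem 5 = e)
    (h6 : mem 6 = s) (hS : Represents mem S) :
    Halts (learnerTime n d (numBits e s) (numTrials k d a b) (numPasses k a) M)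
      ⟨[learnerProgram f], r, mem, []⟩
      (outputLaw f (numBits e s) (numTrials k d a b) [] (schedule d (numPasses k a) n) S) := by
  unfold learnerTime
  set q := numBits e s with hq
  set T := numTrials k d a b with hT
  set J := numPasses k a with hJ
  refine Halts.mono (t := 0 + 1 + J * (passTime n d q T + 5) + 1 + 1 + initTime M + 1) ?_ (by omega)
  refine Halts.block_cons (halts_initProgram hM fun r' hE h7 h8 => Halts.block_cons ?_)
  rw [h0, h1, h2, h3, h4, h5, h6, ← hq, ← hT] at hE
  rw [h0, h3, ← hJ] at h7
  rw [h2] at h8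
  refine Halts.forLoop (c := passTime n d q T) (fun m r' mem' o' μ' => r' 7 = m ∧
    Env f d n q T r' ∧ ∃ (τ : ℕ) (S' : Fin n → Option (Sample d)), τ ≤ n ∧ r' 8 = τ ∧
      Represents mem' S' ∧ μ' = outputLaw f q T o' (schedule d m τ) S') ?_ ?_ ?_ J ?_
  · rintro m r' mem' o' μ' ⟨h, -⟩; exact h
  · rintro r' mem' o' μ' ⟨-, -, τ, S', -, -, -, rfl⟩
    refine Halts.block_nil ?_
    simpa [outputLaw, schedule, learn, encodeFormula, PMF.pure_map] using halts_nil r' mem' o'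
  · rintro m r' mem' o' μ' t' K' ⟨h7, hE', τ, S', hτ, h8, hS', rfl⟩ hK
    refine halts_passProgram hE' h8 hτ hS' fun r₁ mem₁ o₁ S₁ hE₁ h71 h81 hS₁ => ?_
    refine hK _ _ _ _ (h71.trans h7) hE₁.one ⟨by simp, hE₁.congr (b := 7) ?_ le_rfl, τ / 2, S₁,
      (Nat.div_le_self _ _).trans hτ, by simp [h81], hS₁, rfl⟩
    simp [agree_update, Agree.refl]
  · exact ⟨h7, hE, n, S, le_rfl, h8, hS, rfl⟩

end Program

/-! ### The input -/

/-- Reading a list that is composed of blocks of equal length. -/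
lemma getD_flatMap {Z : Type*} {L : ℕ} (g : Z → List ℕ) (hg : ∀ z, (g z).length = L) {j : ℕ}
    (hj : j < L) (l : List Z) : ∀ (s : ℕ) (hs : s < l.length),
    (l.flatMap g).getD (s * L + j) 0 = (g l[s]).getD j 0 := by
  induction l with
  | nil => intro s hs; simp at hs
  | cons z l ih =>
    intro s hs
    rw [List.flatMap_cons]
    cases s with
    | zero =>
      rw [zero_mul, zero_add, List.getD_append _ _ _ _ (by rw [hg]; exact hj)]; rfl
    | succ s =>
      rw [List.getD_append_right _ _ _ _ (by rw [hg, Nat.succ_mul]; omega), hg,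
        show (s + 1) * L + j - L = s * L + j by rw [Nat.succ_mul]; omega]
      exact ih s (by simpa using hs)

lemma represents_learnerInput {n d : ℕ} (k : ℕ) (α β ε δ : ℝ) (S : Fin n → Sample d) :
    Represents (fun i => (learnerInput k α β ε δ S).getD i 0) fun i => some (S i) := by
  have key : ∀ (s : Fin n) (j : ℕ), j < d + 1 →
      (learnerInput k α β ε δ S).getD (7 + s * (d + 1) + j) 0 =
        ((List.ofFn fun i => ((S s).1 i).toNat) ++ [(S s).2.toNat]).getD j 0 := by
    intro s j hj
    have h := getD_flatMap (fun z : Sample d => (List.ofFn fun i => (z.1 i).toNat) ++ [z.2.toNat])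
      (L := d + 1) (fun z => by simp) hj (List.ofFn S) s (by simp)
    rw [learnerInput, List.getD_append_right _ _ _ _ (by simp; omega)]
    simp only [List.length_cons, List.length_nil]
    rw [show 7 + (s : ℕ) * (d + 1) + j - (0 + 1 + 1 + 1 + 1 + 1 + 1 + 1) = s * (d + 1) + j by omega,
      h]
    simp
  refine fun s => ⟨fun h => by simp at h, fun z hz => ?_⟩
  obtain rfl := Option.some.inj hz
  refine ⟨fun j => ?_, ?_⟩
  · simp only []
    rw [key s j (by omega), List.getD_append _ _ _ _ (by simp)]
    simp
  · simp only []
    rw [key s d (by omega), List.getD_append_right _ _ _ _ (by simp)]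
    simp

lemma size_le_self (x : ℕ) : x.size ≤ x := Nat.size_le.2 Nat.lt_two_pow_self

lemma learnerTime_le {n d k a b e s N : ℕ} (h : n + d + k + a + e + b.size + s.size = N) :
    learnerTime n d (numBits e s) (numTrials k d a b) (numPasses k a) N ≤ 30000 * (N + 1) ^ 5 := by
  have hk := size_le_self k
  have hd := size_le_self d
  have ha := size_le_self a
  have he := size_le_self e
  have hs := size_le_self s.size
  set M := N + 1 with hM
  have hJ : numPasses k a ≤ 4 * M := by unfold numPasses; omega
  have hT : numTrials k d a b ≤ 8 * M := by unfold numTrials; omega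
  have hq : numBits e s * 10 + 18 ≤ 88 * M := by unfold numBits; omega
  have hn : n ≤ M := by omega
  have hd' : d ≤ M := by omega
  have p1 : ∀ j, 1 ≤ M ^ j := fun j => Nat.one_le_pow _ _ (by omega)
  have h13 : M ≤ M ^ 3 := Nat.le_self_pow (by norm_num) M
  have hQ : queryTime n (numBits e s) (numTrials k d a b) ≤ 1700 * M ^ 3 := by
    unfold queryTime
    calc n * 64 + numTrials k d a b * (2 * n * (numBits e s * 10 + 18) + 20) + 50
        ≤ M * 64 + 8 * M * (2 * M * (88 * M) + 20) + 50 := by gcongr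
      _ = 224 * M + 1408 * M ^ 3 + 50 := by ring
      _ ≤ 1700 * M ^ 3 := by have := p1 3; omega
  have hP : passTime n d (numBits e s) (numTrials k d a b) + 5 ≤ 3432 * M ^ 4 := by
    unfold passTime
    calc d * (2 * queryTime n (numBits e s) (numTrials k d a b) + 18) + 9 + 5
        ≤ M * (2 * (1700 * M ^ 3) + 18 * M ^ 3) + 9 + 5 := by
          gcongr; exact Nat.le_mul_of_pos_right _ (p1 3)
      _ = 3418 * M ^ 4 + 14 := by ring
      _ ≤ 3432 * M ^ 4 := by have := p1 4; omega
  unfold learnerTime initTime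
  calc numPasses k a * (passTime n d (numBits e s) (numTrials k d a b) + 5) + (42 * N + 110) + 4
      ≤ 4 * M * (3432 * M ^ 4) + (42 * M + 110) + 4 := by gcongr; omega
    _ = 13728 * M ^ 5 + 42 * M + 114 := by ring
    _ ≤ 30000 * M ^ 5 := by
      have := p1 5
      have : M ≤ M ^ 5 := Nat.le_self_pow (by norm_num) M
      omega

/-! ### The learning theorem -/

/-- The learner for both classes: conjunctions are the case `f = false`, disjunctions the case
`f = true`. -/
theorem hasEfficientPrivateLearner_hypothesis (f : Bool) :
    HasEfficientPrivateLearner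
      (fun k _ => {c | ∃ φ, φ.length ≤ k ∧ c = hypothesis f φ}) (fun _ => hypothesis f)
      fun k d α β ε δ => 30000000 * (1 / (α * ε) * (k : ℝ) * Real.log (d : ℝ)) *
        Real.log (2 * (k : ℝ) / (α * β * ε * δ)) ^ 3 := by
  refine ⟨learnerProgram f, 30000 * (Polynomial.X + 1) ^ 5, ?_⟩
  intro k d hk hd α hα β hβ ε hε δ hδ n
  set a := ⌈1 / α⌉₊ with ha
  set b := ⌈1 / β⌉₊ with hb
  set e := ⌈1 / ε⌉₊ with he
  set s := ⌈1 / δ⌉₊ with hs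
  set q := numBits e s with hq
  set T := numTrials k d a b with hT
  set J := numPasses k a with hJ
  refine ⟨fun S => learn f q T (schedule d J n) fun i => some (S i), fun S => ?_, ?_, fun hn => ?_⟩
  · set w := learnerInput k α β ε δ S with hw
    have hM : ∀ i < 7, (w.getD i 0).size ≤ problemSize n k d α β ε δ := by
      intro i hi
      have := size_le_self n
      have := size_le_self d
      have := size_le_self k
      have := size_le_self a
      have := size_le_self e
      have hN : problemSize n k d α β ε δ = n + d + k + a + e + b.size + s.size := rfl
      rw [hN]
      interval_cases i
      · change k.size ≤ _; omega
      · change d.size ≤ _; omega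
      · change n.size ≤ _; omega
      · change a.size ≤ _; omega
      · change b.size ≤ _; omega
      · change e.size ≤ _; omega
      · change s.size ≤ _; omega
    have h := halts_learnerProgram (f := f) (r := Function.update (fun _ => 0) 0 w.length)
      (mem := fun i => w.getD i 0) (k := k) (d := d) (n := n) (a := a) (b := b) (e := e) (s := s)
      hM rfl rfl rfl rfl rfl rfl rfl (represents_learnerInput k α β ε δ S)
    have htime := learnerTime_le (n := n) (d := d) (k := k) (a := a) (b := b) (e := e) (s := s)
      (N := problemSize n k d α β ε δ) rfl
    have h' := h _ htime
    have hlaw : outputLaw f q T [] (schedule d J n) (fun i => some (S i)) =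
        (learn f q T (schedule d J n) fun i => some (S i)).map encodeFormula := by
      simp [outputLaw]
    rw [hlaw] at h'
    have heval : Polynomial.eval (problemSize n k d α β ε δ) (30000 * (Polynomial.X + 1) ^ 5) =
        30000 * (problemSize n k d α β ε δ + 1) ^ 5 := by simp
    rw [Program.HasOutputLaw, heval]
    exact h'
  · exact isDifferentiallyPrivate_learn f T _ hε hδ.1 (by rw [hq]; unfold numBits; omega)
      (le_mul_two_pow_numBits hε hδ)
  · obtain ⟨E, hE⟩ : ∃ E, E = deficitBound k d a b e s := ⟨_, rfl⟩
    obtain ⟨n1, n2, n3⟩ := sampleSize_bounds hk hd hα hβ hε hδ hn hJ hE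
    obtain ⟨η, f1, f2, f3⟩ := failure_le (k := k) (d := d) (a := a) hβ e s
    rw [← hE] at f2
    have hEpos : 0 < E := hE ▸ deficitBound_pos k d a b e s
    refine isPACLearner_of_errorCount f hα.1 hβ.1 (L := J * (5 * k)) _ ?_ n3
    intro φ hφ x
    refine (pr_mono _ ?_).trans ((pr_not_typical_le f hEpos f1 f2 (schedule d J n)
      fun i => some (x i, hypothesis f φ (x i))).trans (by rw [length_schedule]; exact f3))
    intro ψ hψ htyp
    obtain ⟨g1, g2⟩ := Typical.errorCount_le hEpos hk hφ n1 htyp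
    exact hψ ⟨g1, le_trans (by exact_mod_cast g2) n2⟩

lemma CONJ_eq : CONJ = fun k d => {c | ∃ φ : List (Literal d), φ.length ≤ k ∧
    c = hypothesis false φ} := by
  funext k d; simp only [CONJ, hypothesis_false]

lemma DISJ_eq : DISJ = fun k d => {c | ∃ φ : List (Literal d), φ.length ≤ k ∧
    c = hypothesis true φ} := by
  funext k d; simp only [DISJ, hypothesis_true]

lemma conjEval_eq : (fun d => conjEval (d := d)) = fun _ => hypothesis false := by
  funext d φ; exact (hypothesis_false φ).symm

lemma disjEval_eq : (fun d => disjEval (d := d)) = fun _ => hypothesis true := by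
  funext d φ; exact (hypothesis_true φ).symm

end PrivateLearning

theorem mainTheorem3 :
    ∃ (c : ℝ) (m : ℕ),
      PrivateLearning.HasEfficientPrivateLearner PrivateLearning.CONJ
        (fun _ => PrivateLearning.conjEval)
        (fun k d α β ε δ =>
          c * (1 / (α * ε) * (k : ℝ) * Real.log (d : ℝ)) *
            Real.log (2 * (k : ℝ) / (α * β * ε * δ)) ^ m) ∧
      PrivateLearning.HasEfficientPrivateLearner PrivateLearning.DISJ
        (fun _ => PrivateLearning.disjEval)
        (fun k d α β ε δ =>
          c * (1 / (α * ε) * (k : ℝ) * Real.log (d : ℝ)) *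
            Real.log (2 * (k : ℝ) / (α * β * ε * δ)) ^ m) := by
  refine ⟨30000000, 3, ?_, ?_⟩
  · rw [PrivateLearning.CONJ_eq, PrivateLearning.conjEval_eq]
    exact PrivateLearning.hasEfficientPrivateLearner_hypothesis false
  · rw [PrivateLearning.DISJ_eq, PrivateLearning.disjEval_eq]
    exact PrivateLearning.hasEfficientPrivateLearner_hypothesis true
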